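/- Let $H=\mathrm{SL}(2,\mathbb R)$, $V=\mathbb R^3$, $G=\mathrm{SL}(3,\mathbb R)$. Let $\Gamma$ be the fundamental group of a closed hyperbolic surface, embedded by an injective morphism $\iota:\Gamma\to H$ with discrete image; that is, $\Gamma$ is torsion-free, $\iota$ is injective, $\iota(\Gamma)$ is discrete and $M=\iota(\Gamma)\backslash H$ is compact. Let $\Phi^t$ be the flow on $M$ induced by right translation by $a^t=\mathrm{diag}(e^t,e^{-t})$. Let $Y$ be the frame variety of triples $([u],[v],[w])$ of non-collinear points of $P(V)$, with its projections $\pi_+([u],[v],[w])=([u],[uv])$ and $\pi_-([u],[v],[w])=([w],[wv])$ to the flag variety (the second entry is the projective line through the two points), and let $E^\pm\subset TY$ be the tangent bundle to the fibres of $\pi_\pm$. For a representation $\rho:\Gamma\to G$ let $E_\rho=\Gamma\backslash(H\times Y)$ be the quotient by $\gamma(h,y)=(\iota(\gamma)h,\rho(\gamma)y)$, with projection $\pi_\rho:E_\rho\to M$, let $\Phi_\rho^t$ be the flow on $E_\rho$ induced by $(h,y)\mapsto(ha^t,y)$, and let $E^\pm_\rho$ be the vertical bundles over $E_\rho$ induced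 by $E^\pm$. The representation $\rho$ is $(G,Y)$-Anosov if there is a continuous section $s$ of $\pi_\rho$ whose image $S$ is $\Phi^t_\rho$-invariant and such that for every continuous norm $\|\cdot\|$ on the vertical tangent bundle of $E_\rho$ there are $a,b>0$ with $$\|D_p\Phi_\rho^{t}(v^+)\|\le b e^{-at}\|v^+\|,\qquad \|D_p\Phi_\rho^{-t}(v^-)\|\le b e^{-at}\|v^-\|$$ for all $p\in S$, $t>0$, $v^+\in E^+_\rho$ over $p$ and $v^-\in E^-_\rho$ over $p$. Let $\rho_0:H\to G$ be the embedding $$\begin{pmatrix}a&b\\c&d\end{pmatrix}\mapsto\begin{pmatrix}a&0&b\\0&1&0\\c&0&d\end{pmatrix},$$ let $\varphi^t=\mathrm{diag}(e^{t/3},e^{-2t/3},e^{t/3})$, and for a morphism $u:\Gamma\to\mathbb R$, i.e. $u\in H^1(\Gamma,\mathbb R)$, let $\rho_u(\gamma)=\varphi^{u(\gamma)}\rho_0(\iota(\gamma))$ be the linear $u$-deformation of the canonical representation $\rho_0\circ\iota$. For $\gamma\in\Gamma$ let $t(\gamma)=2\log r(\gamma)$, where $r(\gamma)$ is the spectral radius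 of $\iota(\gamma)$. For $c\in H_1(\Gamma,\mathbb Z)$ and $n\ge1$ let $t_n(c)$ be the infimum of $t(\gamma)/n$ over all $\gamma\in\Gamma$ representing $nc$. The stable norm of $c$ is $\lim_n t_n(c)$; it extends uniquely to a norm on $H_1(\Gamma,\mathbb R)$, whose dual norm on $H^1(\Gamma,\mathbb R)$ is the stable norm $|u|_s$. Theorem. For every morphism $u:\Gamma\to\mathbb R$, the representation $\rho_u$ is $(G,Y)$-Anosov if and only if $|u|_s<1/2$. -/

import Mathlib

open scoped LinearAlgebra.Projectivization TensorProduct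

noncomputable section

namespace FlagAnosov

/-! ### The groups `H = SL(2,ℝ)`, `G = SL(3,ℝ)` and the diagonal flow -/

/-- The group `H = SL(2,ℝ)`. -/
abbrev H := Matrix.SpecialLinearGroup (Fin 2) ℝ

/-- The vector space `V = ℝ³`. -/
abbrev V := Fin 3 → ℝ

/-- The group `G = SL(V) = SL(3,ℝ)`. -/
abbrev G := Matrix.SpecialLinearGroup (Fin 3) ℝ

/-- The one-parameter subgroup `a^t = diag(e^t, e^{-t})` of `H`. -/
def aFlow (t : ℝ) : H :=
  ⟨!![Real.exp t, 0; 0, Real.exp (-t)], by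
    rw [Matrix.det_fin_two_of, ← Real.exp_add]; simp⟩

/-! ### The frame variety `Y` and its tangent bundle -/

/-- The projective space carries the quotient topology of `V ∖ {0}`. -/
instance projTopology : TopologicalSpace (ℙ ℝ V) :=
  TopologicalSpace.coinduced (Projectivization.mk' ℝ) inferInstance

/-- The frame variety `Y`: triples of non-collinear points of `P(V)`, with the subspace topology
of the product topology. -/
abbrev Frame := {y : Fin 3 → ℙ ℝ V // Projectivization.Independent y}

theorem independent_smul (g : G) {y : Fin 3 → ℙ ℝ V} (hy : Projectivization.Independent y) :
    Projectivization.Independent (g • y) := by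
  rw [Projectivization.independent_iff] at hy
  have hne : ∀ i, g • (y i).rep ≠ 0 := fun i =>
    (smul_ne_zero_iff_ne g).mpr (y i).rep_nonzero
  have h : g • y = fun i => Projectivization.mk ℝ (g • (y i).rep) (hne i) := by
    funext i
    rw [Pi.smul_apply, ← Projectivization.smul_mk g (y i).rep_nonzero, Projectivization.mk_rep]
  rw [h]
  refine Projectivization.Independent.mk _ hne ?_
  exact hy.map' (DistribMulAction.toModuleEnd ℝ V g)
    (LinearMap.ker_eq_bot.mpr (DistribMulAction.toLinearEquiv ℝ V g).injective)

/-- The diagonal action of `G` on the frame variety. -/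
instance frameAction : MulAction G Frame where
  smul g y := ⟨g • y.1, independent_smul g y.2⟩
  one_smul y := Subtype.ext (one_smul G y.1)
  mul_smul g g' y := Subtype.ext (mul_smul g g' y.1)

/-- The endomorphisms of `V` that preserve the subspace `W`. -/
def preserving (W : Submodule ℝ V) : Submodule ℝ (Matrix (Fin 3) (Fin 3) ℝ) where
  carrier := {ξ | ∀ v ∈ W, ξ.mulVec v ∈ W}
  add_mem' hξ hη v hv := by
    rw [Matrix.add_mulVec]; exact W.add_mem (hξ v hv) (hη v hv)
  zero_mem' v _ := by rw [Matrix.zero_mulVec]; exact W.zero_mem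
  smul_mem' c ξ hξ v hv := by
    rw [Matrix.smul_mulVec]; exact W.smul_mem c (hξ v hv)

/-- The infinitesimal stabilizer of the frame `y`: the endomorphisms that preserve its lines. -/
def isotropy (y : Frame) : Submodule ℝ (Matrix (Fin 3) (Fin 3) ℝ) :=
  ⨅ i, preserving (y.1 i).submodule

/-- The tangent space `T_y Y` of the homogeneous space `Y`: the class of `ξ` is the velocity at
`s = 0` of the curve `exp(sξ) • y`, and it vanishes exactly when `ξ` preserves the lines of `y`.
(Scalar endomorphisms act trivially, so `gl(V)` gives the same quotient as `sl(V)`.) -/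
abbrev FrameTangent (y : Frame) := Matrix (Fin 3) (Fin 3) ℝ ⧸ isotropy y

/-- The projection `π₊([u],[v],[w]) = ([u],[uv])` to the flag variety, the flag being given by its
line and its plane in `V`. -/
def piPlus (y : Frame) : Submodule ℝ V × Submodule ℝ V :=
  ((y.1 0).submodule, (y.1 0).submodule ⊔ (y.1 1).submodule)

/-- The projection `π₋([u],[v],[w]) = ([w],[wv])` to the flag variety. -/
def piMinus (y : Frame) : Submodule ℝ V × Submodule ℝ V :=
  ((y.1 2).submodule, (y.1 2).submodule ⊔ (y.1 1).submodule)

/-- The infinitesimal stabilizer of a flag. -/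
def flagIsotropy (x : Submodule ℝ V × Submodule ℝ V) :
    Submodule ℝ (Matrix (Fin 3) (Fin 3) ℝ) :=
  preserving x.1 ⊓ preserving x.2

/-- `E⁺`, the tangent bundle to the fibres of `π₊`: the vectors represented by the `ξ` that
infinitesimally fix `π₊(y)`. -/
def EPlus (y : Frame) : Submodule ℝ (FrameTangent y) :=
  (flagIsotropy (piPlus y)).map (isotropy y).mkQ

/-- `E⁻`, the tangent bundle to the fibres of `π₋`. -/
def EMinus (y : Frame) : Submodule ℝ (FrameTangent y) :=
  (flagIsotropy (piMinus y)).map (isotropy y).mkQ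

/-! ### The closed manifold `M = Γ\H`, the flat bundle `E_ρ` and the flows -/

section Bundle

variable {Γ : Type*} [Group Γ]

/-- The orbit relation of the left translations of `H` by `ι(Γ)`. -/
def orbitSetoid (ι : Γ →* H) : Setoid H where
  r h h' := ∃ γ : Γ, h' = ι γ * h
  iseqv :=
    { refl := fun h => ⟨1, by simp⟩
      symm := by
        rintro h _ ⟨γ, rfl⟩
        exact ⟨γ⁻¹, by simp⟩
      trans := by
        rintro h _ _ ⟨γ, rfl⟩ ⟨δ, rfl⟩
        exact ⟨δ * γ, by simp [mul_assoc]⟩ }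

/-- The quotient `M = ι(Γ)\H`, with the quotient topology. -/
abbrev M (ι : Γ →* H) := Quotient (orbitSetoid ι)

/-- The orbit relation of `γ(h, y) = (ι(γ)h, ρ(γ)y)` on `H × Y`. -/
def bundleSetoid (ι : Γ →* H) (ρ : Γ →* G) : Setoid (H × Frame) where
  r p q := ∃ γ : Γ, q = (ι γ * p.1, ρ γ • p.2)
  iseqv :=
    { refl := fun p => ⟨1, by simp⟩
      symm := by
        rintro p _ ⟨γ, rfl⟩
        exact ⟨γ⁻¹, by simp⟩
      trans := by
        rintro p _ _ ⟨γ, rfl⟩ ⟨δ, rfl⟩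
        exact ⟨δ * γ, by simp [mul_assoc, mul_smul]⟩ }

/-- The total space `E_ρ = Γ\(H × Y)` of the flat `(G,Y)`-bundle, with the quotient topology. -/
abbrev E (ι : Γ →* H) (ρ : Γ →* G) := Quotient (bundleSetoid ι ρ)

/-- The bundle projection `π_ρ : E_ρ → M`. -/
def bundleProj (ι : Γ →* H) (ρ : Γ →* G) : E ι ρ → M ι :=
  Quotient.map Prod.fst (by
    rintro p _ ⟨γ, rfl⟩
    exact ⟨γ, rfl⟩)

/-- The horizontal flow `Φ_ρ^t` on `E_ρ`, induced by `(h, y) ↦ (h a^t, y)`. -/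
def flowE (ι : Γ →* H) (ρ : Γ →* G) (t : ℝ) : E ι ρ → E ι ρ :=
  Quotient.map (fun p => (p.1 * aFlow t, p.2)) (by
    rintro p _ ⟨γ, rfl⟩
    exact ⟨γ, by simp [mul_assoc]⟩)

/-- A continuous norm on the vertical tangent bundle `Γ\(H × TY) = E_ρ⁺ ⊕ E_ρ⁻` of `E_ρ`, written
as a `Γ`-invariant continuous family of norms `‖·‖_{(h,y)}` on the spaces `T_y Y`. The differential
of `y ↦ g y` sends the class of `ξ` at `y` to the class of `g ξ g⁻¹` at `g y`. -/
structure VerticalNorm (ι : Γ →* H) (ρ : Γ →* G) where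
  toSeminorm : H → (y : Frame) → Seminorm ℝ (FrameTangent y)
  definite : ∀ h y (v : FrameTangent y), toSeminorm h y v = 0 → v = 0
  continuous : Continuous fun p : H × Frame × Matrix (Fin 3) (Fin 3) ℝ =>
    toSeminorm p.1 p.2.1 ((isotropy p.2.1).mkQ p.2.2)
  invariant : ∀ (γ : Γ) (h : H) (y : Frame) (ξ : Matrix (Fin 3) (Fin 3) ℝ),
    toSeminorm (ι γ * h) (ρ γ • y)
        ((isotropy (ρ γ • y)).mkQ
          ((ρ γ : Matrix (Fin 3) (Fin 3) ℝ) * ξ * ((ρ γ)⁻¹ : G))) =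
      toSeminorm h y ((isotropy y).mkQ ξ)

/-- `s` is the section of a `(G,Y)`-Anosov structure with representation `ρ` over `(M, Φ^t)`.
The differential of `Φ_ρ^t` sends the vertical vector `v ∈ T_y Y` over `[(h, y)]` to the vertical
vector `v` over `[(h a^t, y)]`. -/
structure IsAnosovSection (ι : Γ →* H) (ρ : Γ →* G) (s : M ι → E ι ρ) : Prop where
  continuous : Continuous s
  isSection : ∀ p, bundleProj ι ρ (s p) = p
  invariant : ∀ t : ℝ, Set.MapsTo (flowE ι ρ t) (Set.range s) (Set.range s)
  hyperbolic : ∀ N : VerticalNorm ι ρ, ∃ a > 0, ∃ b > 0,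
    ∀ (h : H) (y : Frame), (Quotient.mk (bundleSetoid ι ρ) (h, y)) ∈ Set.range s →
      ∀ t : ℝ, 0 < t →
        (∀ v ∈ EPlus y, N.toSeminorm (h * aFlow t) y v ≤
          b * Real.exp (-a * t) * N.toSeminorm h y v) ∧
        (∀ v ∈ EMinus y, N.toSeminorm (h * aFlow (-t)) y v ≤
          b * Real.exp (-a * t) * N.toSeminorm h y v)

/-- The representation `ρ` is `(G,Y)`-Anosov (relative to `ι`). -/
def IsAnosov (ι : Γ →* H) (ρ : Γ →* G) : Prop :=
  ∃ s : M ι → E ι ρ, IsAnosovSection ι ρ s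

/-- `ι` embeds `Γ` in `H` as the fundamental group of a closed hyperbolic surface: it is injective
with discrete image, `Γ` has no torsion, and `M = ι(Γ)\H` is compact. -/
structure IsClosedSurfaceEmbedding (ι : Γ →* H) : Prop where
  injective : Function.Injective ι
  discrete : DiscreteTopology ι.range
  torsionFree : ∀ γ : Γ, γ ≠ 1 → ¬ IsOfFinOrder γ
  cocompact : CompactSpace (M ι)

end Bundle

/-! ### Canonical representations and their linear deformations -/

/-- The matrix of `ρ₀(h)` for a `2 × 2` matrix `h`. -/
def rho0Matrix (h : Matrix (Fin 2) (Fin 2) ℝ) : Matrix (Fin 3) (Fin 3) ℝ :=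
  !![h 0 0, 0, h 0 1;
     0, 1, 0;
     h 1 0, 0, h 1 1]

theorem rho0Matrix_one : rho0Matrix 1 = 1 := by
  ext i j
  fin_cases i <;> fin_cases j <;> simp [rho0Matrix]

theorem rho0Matrix_mul (g h : Matrix (Fin 2) (Fin 2) ℝ) :
    rho0Matrix (g * h) = rho0Matrix g * rho0Matrix h := by
  ext i j
  fin_cases i <;> fin_cases j <;>
    simp [rho0Matrix, Matrix.mul_apply, Fin.sum_univ_two, Fin.sum_univ_three]

theorem rho0Matrix_det (h : Matrix (Fin 2) (Fin 2) ℝ) : (rho0Matrix h).det = h.det := by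
  rw [Matrix.det_fin_two, Matrix.det_fin_three]
  simp [rho0Matrix]

/-- The embedding `ρ₀ : H → G`. -/
def rho0 : H →* G where
  toFun h := ⟨rho0Matrix h.1, (rho0Matrix_det h.1).trans h.2⟩
  map_one' := Subtype.ext rho0Matrix_one
  map_mul' g h := Subtype.ext (rho0Matrix_mul g.1 h.1)

/-- The one-parameter subgroup `φ^t = diag(e^{t/3}, e^{-2t/3}, e^{t/3})` of `G`. -/
def phi (t : ℝ) : G :=
  ⟨!![Real.exp (t / 3), 0, 0; 0, Real.exp (-2 * t / 3), 0; 0, 0, Real.exp (t / 3)], by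
    rw [Matrix.det_fin_three]
    simp [← Real.exp_add]
    ring⟩

theorem phi_zero : phi 0 = 1 := by
  ext i j
  fin_cases i <;> fin_cases j <;> simp [phi]

theorem phi_add (s t : ℝ) : phi (s + t) = phi s * phi t := by
  refine Subtype.ext ?_
  rw [Matrix.SpecialLinearGroup.coe_mul]
  ext i j
  fin_cases i <;> fin_cases j <;>
    simp [phi, Matrix.mul_apply, Fin.sum_univ_three, ← Real.exp_add] <;> ring

theorem phi_comm (t : ℝ) (h : H) : phi t * rho0 h = rho0 h * phi t := by
  refine Subtype.ext ?_
  change (phi t).1 * rho0Matrix h.1 = rho0Matrix h.1 * (phi t).1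
  ext i j
  fin_cases i <;> fin_cases j <;>
    simp [phi, rho0Matrix, Matrix.mul_apply, Fin.sum_univ_three, mul_comm]

section Deformation

variable {Γ : Type*} [Group Γ]

/-- The linear `u`-deformation `ρ_u(γ) = φ^{u(γ)} ρ₀(ι(γ))` of the canonical representation
`ρ₀ ∘ ι`, for a morphism `u : Γ → ℝ`. -/
def linearDeformation (ι : Γ →* H) (u : Γ →* Multiplicative ℝ) : Γ →* G where
  toFun γ := phi (u γ).toAdd * rho0 (ι γ)
  map_one' := by simp [phi_zero]
  map_mul' γ δ := by
    rw [map_mul u, map_mul ι, map_mul rho0, toAdd_mul, phi_add, mul_assoc, mul_assoc,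
      ← mul_assoc (phi (u δ).toAdd), phi_comm, mul_assoc]

/-! ### The stable norm -/

/-- The first homology group `H₁(Γ, ℤ)`. -/
abbrev H1Int (Γ : Type*) [Group Γ] := Additive (Abelianization Γ)

/-- The first homology group `H₁(Γ, ℝ)`. -/
abbrev H1Real (Γ : Type*) [Group Γ] := ℝ ⊗[ℤ] H1Int Γ

/-- The spectral radius `r(γ)` of `ι(γ)`. -/
def specRadius (ι : Γ →* H) (γ : Γ) : ℝ :=
  (spectralRadius ℂ ((ι γ : Matrix (Fin 2) (Fin 2) ℝ).map Complex.ofReal)).toReal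

/-- `t(γ) = 2 log r(γ)`, the length of the closed geodesic associated to `γ`. -/
def transLength (ι : Γ →* H) (γ : Γ) : ℝ :=
  2 * Real.log (specRadius ι γ)

/-- `t_n(c)`: the infimum of `t(γ)/n` over the elements `γ` of `Γ` that represent `n c`. -/
def classLength (ι : Γ →* H) (n : ℕ) (c : H1Int Γ) : ℝ :=
  sInf {x | ∃ γ : Γ, Additive.ofMul (Abelianization.of γ) = n • c ∧ x = transLength ι γ / n}

/-- The stable norm on `H₁(Γ, ℤ)`: the limit of `t_n(c)`. -/
def stableNormInt (ι : Γ →* H) (c : H1Int Γ) : ℝ :=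
  Filter.limUnder Filter.atTop fun n : ℕ => classLength ι n c

/-- The stable norm on `H₁(Γ, ℝ)`: the infimum of `∑ |aᵢ| ‖cᵢ‖` over the expressions
`∑ aᵢ ⊗ cᵢ` of a class with `aᵢ` real and `cᵢ` integral. This is the extension of the stable norm
of `H₁(Γ, ℤ)` to a seminorm on `H₁(Γ, ℝ)`. -/
def stableNormReal (ι : Γ →* H) (c : H1Real Γ) : ℝ :=
  sInf {x | ∃ l : H1Int Γ →₀ ℝ, (l.sum fun e a => a ⊗ₜ[ℤ] e) = c ∧
    x = l.sum fun e a => |a| * stableNormInt ι e}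

/-- The linear form on `H₁(Γ, ℝ)` given by `u ∈ Hom(Γ, ℝ) = H¹(Γ, ℝ)`. -/
def pairing (u : Γ →* Multiplicative ℝ) : H1Real Γ →ₗ[ℝ] ℝ :=
  LinearMap.liftBaseChange ℝ
    (MonoidHom.toAdditiveLeft (Abelianization.lift u)).toIntLinearMap

/-- The stable norm on `H¹(Γ, ℝ)`: the dual norm `sup {|u(c)| : ‖c‖ ≤ 1}`. -/
def stableNorm (ι : Γ →* H) (u : Γ →* Multiplicative ℝ) : ENNReal :=
  ⨆ (c : H1Real Γ) (_ : stableNormReal ι c ≤ 1), ENNReal.ofReal |pairing u c|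

end Deformation

end FlagAnosov

end

open scoped LinearAlgebra.Projectivization TensorProduct

noncomputable section

namespace FlagAnosov

open Filter Topology
open scoped Matrix

/-! ### Cocompact discrete subgroups of `SL(2,ℝ)` -/

/-! Both properties are compared with a third: there is `κ < 1/2` such that `|u(γ)| ≤ κ t(γ)` for
all `γ`. It is equivalent to the bound on the stable norm (`stableNorm_lt_half_iff`). Since `t` is
subadditive up to conjugation and a bounded error, Fekete's lemma gives the limit defining the
stable norm, and the equivalence follows by testing on the classes `a ⊗ [γ]` and passing to
representatives of `n[γ]`.

If the linear bound holds, the section `h ↦ ([ρ₀(h)e₁], [e₂], [ρ₀(h)e₃])` is Anosov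
(`isAnosov_of_abs_le`). In the basis `ρ₀(h)` the flow multiplies matrix entries by exponentials of
differences of the weights `-1, 0, 1`. Bringing the endpoints of a flow segment of length `|t|` back
to a compact set adds a twist by `φ^s`, where `s` is a value of `u` at an element of translation
length at most `2|t| + O(1)`. So `|s| ≤ 2κ|t| + O(1)`, which cannot overcome the weight gap `1`.

Conversely, let `f` be continuous on `H` with `f(γh) = f(h) + u(γ)`. The equivariant map `φ^f ρ₀`
trivializes the flat bundle and turns an Anosov section into a bounded family of frames on which the
flow acts by the diagonal matrices with exponents `-t, x, t` up to a common shift, where `x =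
f(ha^t) - f(h)`. A frame whose lines are separated exponentially in both time directions must be the
coordinate frame up to order (`exists_permutation_of_dominated`). Ordering the exponents leaves
three regimes (`exists_trichotomy`): `|x| ≤ (1-a)t + C`, `x ≥ (1+a)t - C` or `x ≤ -(1+a)t + C`. The
regime is locally constant in `h`, and rotation by `π/2` reverses the flow while moving `f`
boundedly, so the two fast regimes are impossible (`not_fast_regime`). A Cartan decomposition of
`ι(γ)`, after a conjugation making its entries comparable to its spectral radius, yields `|u(γ)| ≤
(1-a)/2 · t(γ) + O(1)`, and powers of `γ` remove the error. -/

instance : LocallyCompactSpace H :=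
  haveI : LocallyCompactSpace (Matrix (Fin 2) (Fin 2) ℝ) :=
    inferInstanceAs (LocallyCompactSpace (Fin 2 → Fin 2 → ℝ))
  Matrix.SpecialLinearGroup.isClosedEmbedding_val.locallyCompactSpace

theorem continuous_aFlow : Continuous aFlow := by
  refine Topology.IsInducing.subtypeVal.continuous_iff.mpr ?_
  refine continuous_matrix fun i j => ?_
  fin_cases i <;> fin_cases j <;> simp <;> fun_prop

theorem aFlow_add (s t : ℝ) : aFlow (s + t) = aFlow s * aFlow t := by
  refine Subtype.ext ?_
  rw [Matrix.SpecialLinearGroup.coe_mul]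
  ext i j
  fin_cases i <;> fin_cases j <;>
    simp [aFlow, Matrix.mul_apply, Fin.sum_univ_two, ← Real.exp_add, add_comm]

theorem aFlow_zero : aFlow 0 = 1 := by
  ext i j
  fin_cases i <;> fin_cases j <;> simp [aFlow]

theorem mul_aFlow_mul_aFlow_neg (h : H) (t : ℝ) : h * aFlow t * aFlow (-t) = h := by
  rw [mul_assoc, ← aFlow_add, add_neg_cancel, aFlow_zero, mul_one]

section Lattice

variable {Γ : Type*} [Group Γ] {ι : Γ →* H}

theorem isOpenMap_mk (ι : Γ →* H) : IsOpenMap (Quotient.mk (orbitSetoid ι)) := by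
  intro U hU
  refine (isQuotientMap_quotient_mk' (s := orbitSetoid ι)).isOpen_preimage.mp ?_
  have : Quotient.mk (orbitSetoid ι) ⁻¹' (Quotient.mk (orbitSetoid ι) '' U) =
      ⋃ γ : Γ, (fun h => ι γ * h) ⁻¹' U := by
    ext h
    simp only [Set.mem_preimage, Set.mem_image, Set.mem_iUnion]
    constructor
    · rintro ⟨h', h'U, e⟩
      obtain ⟨γ, hγ⟩ := Quotient.exact e
      refine ⟨γ⁻¹, ?_⟩
      rw [hγ]
      simpa using h'U
    · rintro ⟨γ, hγ⟩
      exact ⟨_, hγ, Quotient.sound ⟨γ⁻¹, by simp⟩⟩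
  refine this ▸ ?_
  exact isOpen_iUnion fun γ => hU.preimage (continuous_const.mul continuous_id)

/-- A cocompact subgroup has a compact set meeting all its orbits. -/
theorem exists_isCompact_cover (hι : IsClosedSurfaceEmbedding ι) :
    ∃ K : Set H, IsCompact K ∧ ∀ h : H, ∃ γ : Γ, ∃ k ∈ K, h = ι γ * k := by
  have := hι.cocompact
  choose C hC hC1 using fun h : H => exists_compact_mem_nhds h
  obtain ⟨t, -, ht⟩ := (isCompact_univ (X := M ι)).elim_nhds_subcover
    (fun p => Quotient.mk (orbitSetoid ι) '' interior (C p.out)) (fun p _ => by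
      refine ((isOpenMap_mk ι) _ isOpen_interior).mem_nhds ?_
      exact ⟨p.out, mem_interior_iff_mem_nhds.mpr (hC1 _), Quotient.out_eq p⟩)
  refine ⟨⋃ p ∈ t, C p.out, t.isCompact_biUnion fun p _ => hC _, fun h => ?_⟩
  obtain ⟨p, hp, k, hk, e⟩ := Set.mem_iUnion₂.mp
    (ht (Set.mem_univ (Quotient.mk (orbitSetoid ι) h)))
  obtain ⟨γ, hγ⟩ := Quotient.exact e
  exact ⟨γ, k, Set.mem_iUnion₂.mpr ⟨p, hp, interior_subset hk⟩, hγ⟩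

/-- Such a `γ` has `ι γ` in the compact set `L K⁻¹`, and an injective map onto a discrete subgroup
is proper. -/
theorem finite_setOf_mul_mem (hι : IsClosedSurfaceEmbedding ι) {K L : Set H} (hK : IsCompact K)
    (hL : IsCompact L) : {γ : Γ | ∃ h ∈ K, ι γ * h ∈ L}.Finite := by
  have hd : IsDiscrete (ι.range : Set H) := isDiscrete_iff_discreteTopology.mpr hι.discrete
  have ht := ι.tendsto_coe_cofinite_of_discrete hι.injective hd
  have hc : IsCompact ((fun p : H × H => p.1 * p.2⁻¹) '' (L ×ˢ K)) :=
    (hL.prod hK).image (by fun_prop)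
  have := ht.eventually hc.compl_mem_cocompact
  rw [eventually_cofinite] at this
  refine this.subset ?_
  rintro γ ⟨h, hh, hγ⟩
  simp only [not_not, Set.mem_ofPred_eq]
  exact ⟨(ι γ * h, h), ⟨hγ, hh⟩, by simp⟩

/-- A discrete group acts freely and locally without returns. -/
theorem exists_nhds_eq_one_of_mul_mem (hι : IsClosedSurfaceEmbedding ι) (h₀ : H) :
    ∃ W : Set H, IsOpen W ∧ h₀ ∈ W ∧ ∀ (γ : Γ), ∀ h ∈ W, ι γ * h ∈ W → γ = 1 := by
  have := hι.discrete
  have h1 : IsOpen ({1} : Set ι.range) := isOpen_discrete _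
  obtain ⟨U, hU, hU1⟩ := isOpen_induced_iff.mp h1
  have hmem : (1 : H) ∈ U := by
    have : (1 : ι.range) ∈ (Subtype.val ⁻¹' U : Set ι.range) := by rw [hU1]; rfl
    exact this
  have hc : ContinuousAt (fun p : H × H => p.1 * p.2⁻¹) (h₀, h₀) := by fun_prop
  have hn : (fun p : H × H => p.1 * p.2⁻¹) ⁻¹' U ∈ 𝓝 (h₀, h₀) :=
    hc.preimage_mem_nhds (hU.mem_nhds (by simpa using hmem))
  obtain ⟨A, hA, B, hB, hAB⟩ := mem_nhds_prod_iff.mp hn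
  obtain ⟨W, hWs, hW, hW0⟩ := mem_nhds_iff.mp (inter_mem hA hB)
  refine ⟨W, hW, hW0, fun γ h hh hγ => ?_⟩
  have h2 : (ι γ * h, h) ∈ (fun p : H × H => p.1 * p.2⁻¹) ⁻¹' U :=
    hAB ⟨(hWs hγ).1, (hWs hh).2⟩
  have h3 : ι γ ∈ U := by simpa using h2
  have h4 : (⟨ι γ, ⟨γ, rfl⟩⟩ : ι.range) ∈ (Subtype.val ⁻¹' U : Set ι.range) := h3
  rw [hU1] at h4
  have h5 : ι γ = 1 := congrArg Subtype.val h4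
  exact hι.injective (h5.trans (map_one ι).symm)

/-- Every class of `H¹(Γ, ℝ)` is the class of periods of a continuous function on `H`. -/
theorem exists_continuous_equivariant (hι : IsClosedSurfaceEmbedding ι)
    (u : Γ →* Multiplicative ℝ) :
    ∃ f : H → ℝ, Continuous f ∧ ∀ γ h, f (ι γ * h) = f h + (u γ).toAdd := by
  obtain ⟨K, hK, hcov⟩ := exists_isCompact_cover hι
  obtain ⟨ψ, hψ1, -, hψc, hψ0⟩ := exists_continuous_one_zero_of_isCompact hK isClosed_empty
    (Set.disjoint_empty K)
  -- A Poincaré series: the sum over `γ` is locally finite and positive, translation by `δ`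
  -- multiplies it by `exp (u δ)`, and its logarithm is the required function.
  set F : Γ → H → ℝ := fun γ h => Real.exp (-(u γ).toAdd) * ψ (ι γ * h) with hF
  have hF0 : ∀ γ h, 0 ≤ F γ h := fun γ h => mul_nonneg (Real.exp_pos _).le (hψ0 _).1
  have hlf : LocallyFinite fun γ => Function.support (F γ) := by
    intro h
    obtain ⟨C, hC, hCh⟩ := exists_compact_mem_nhds h
    refine ⟨C, hCh, (finite_setOf_mul_mem hι hC hψc).subset ?_⟩
    rintro γ ⟨h', h'1, h'2⟩
    exact ⟨h', h'2, subset_tsupport _ (right_ne_zero_of_mul h'1)⟩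
  have hcont : Continuous fun h => ∑ᶠ γ, F γ h :=
    continuous_finsum (fun γ => by simp only [hF]; fun_prop) hlf
  have hfin : ∀ h, (Function.support fun γ => F γ h).Finite := fun h => hlf.point_finite h
  have hpos : ∀ h, 0 < ∑ᶠ γ, F γ h := by
    intro h
    obtain ⟨γ, k, hk, e⟩ := hcov h
    refine finsum_pos (fun γ => hF0 γ h) ⟨γ⁻¹, ?_⟩ (hfin h)
    have : ι γ⁻¹ * h = k := by rw [e]; simp
    simp only [hF, this, hψ1 hk]
    simpa using Real.exp_pos _
  refine ⟨fun h => Real.log (∑ᶠ γ, F γ h), hcont.log fun h => (hpos h).ne', fun δ h => ?_⟩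
  have hsh : ∑ᶠ γ, F γ (ι δ * h) = Real.exp (u δ).toAdd * ∑ᶠ γ, F γ h := by
    rw [mul_finsum, ← finsum_comp_equiv (Equiv.mulRight δ)
      (f := fun γ => Real.exp (u δ).toAdd * F γ h)]
    refine finsum_congr fun γ => ?_
    simp only [hF, Equiv.coe_mulRight, map_mul, toAdd_mul, Real.exp_add, Real.exp_neg]
    rw [mul_assoc (ι γ)]
    have := (Real.exp_pos (Multiplicative.toAdd (u δ))).ne'
    field_simp
  simp only [hsh]
  rw [Real.log_mul (Real.exp_pos _).ne' (hpos h).ne', Real.log_exp, add_comm]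

theorem exists_abs_le_of_invariant (hι : IsClosedSurfaceEmbedding ι) {F : H → ℝ}
    (hF : Continuous F) (hinv : ∀ γ h, F (ι γ * h) = F h) : ∃ C > 0, ∀ h, |F h| ≤ C := by
  obtain ⟨K, hK, hcov⟩ := exists_isCompact_cover hι
  obtain ⟨C, hC⟩ := hK.exists_bound_of_continuousOn hF.continuousOn
  refine ⟨max C 1, by positivity, fun h => ?_⟩
  obtain ⟨γ, k, hk, rfl⟩ := hcov h
  rw [hinv]
  exact (hC k hk).trans (le_max_left _ _)

end Lattice

/-! ### Spectral radii in `SL(2,ℝ)` -/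

theorem mem_spectrum_iff (A : H) (k : ℂ) :
    k ∈ spectrum ℂ ((A : Matrix (Fin 2) (Fin 2) ℝ).map Complex.ofReal) ↔
      k ^ 2 - (A 0 0 + A 1 1 : ℝ) * k + 1 = 0 := by
  rw [spectrum.mem_iff, Matrix.isUnit_iff_isUnit_det, isUnit_iff_ne_zero, not_not,
    Matrix.det_fin_two]
  have hdet : ((A 0 0 : ℝ) : ℂ) * A 1 1 - A 0 1 * A 1 0 = 1 := by
    have := A.2
    rw [Matrix.det_fin_two] at this
    exact_mod_cast this
  have e : ∀ i j, (algebraMap ℂ (Matrix (Fin 2) (Fin 2) ℂ) k -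
      (A : Matrix (Fin 2) (Fin 2) ℝ).map Complex.ofReal) i j =
        (if i = j then k else 0) - (A i j : ℝ) := by
    intro i j
    simp [Matrix.algebraMap_matrix_apply]
  simp only [e]
  simp only [if_true, if_neg (zero_ne_one : (0 : Fin 2) ≠ 1), if_neg (one_ne_zero : (1 : Fin 2) ≠ 0)]
  push_cast
  constructor <;> intro h
  · linear_combination h - hdet
  · linear_combination h + hdet

theorem entry_mul_le {A B : Matrix (Fin 2) (Fin 2) ℝ} {a b : ℝ} (hA : ∀ i j, |A i j| ≤ a)
    (hB : ∀ i j, |B i j| ≤ b) (i j : Fin 2) : |(A * B) i j| ≤ 2 * (a * b) := by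
  rw [Matrix.mul_apply, Fin.sum_univ_two]
  have h0 : 0 ≤ a := (abs_nonneg _).trans (hA 0 0)
  have key : ∀ l, |A i l * B l j| ≤ a * b := fun l => by
    rw [abs_mul]; exact mul_le_mul (hA _ _) (hB _ _) (abs_nonneg _) h0
  linarith [abs_add_le (A i 0 * B 0 j) (A i 1 * B 1 j), key 0, key 1]

/-- An element of `SL(2,ℝ)` is conjugate to one whose entries are controlled by the trace. -/
theorem exists_conj_entry_le (A : H) :
    ∃ h : H, ∀ i j, |(h⁻¹ * A * h) i j| ≤ |A 0 0 + A 1 1| + 1 := by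
  have hdet : A 0 0 * A 1 1 - A 0 1 * A 1 0 = 1 := by
    have := A.2
    rwa [Matrix.det_fin_two] at this
  by_cases hdiag : A 0 1 = 0 ∧ A 1 0 = 0
  · refine ⟨1, ?_⟩
    have h1 : 0 < A 0 0 * A 1 1 := by rw [hdiag.1] at hdet; linarith
    have h2 : |A 0 0 + A 1 1| = |A 0 0| + |A 1 1| := by
      rcases mul_pos_iff.mp h1 with h | h
      · rw [abs_of_pos h.1, abs_of_pos h.2, abs_of_pos (add_pos h.1 h.2)]
      · rw [abs_of_neg h.1, abs_of_neg h.2, abs_of_neg (add_neg h.1 h.2)]; ring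
    have h3 := abs_nonneg (A 0 0)
    have h4 := abs_nonneg (A 1 1)
    intro i j
    rw [h2, inv_one, one_mul, mul_one]
    fin_cases i <;> fin_cases j <;> simp [hdiag.1, hdiag.2] <;> linarith
  -- Here `q = det(v, Av)` with `v = (x, y)` a coordinate vector that is not an eigenvector. In the
  -- basis `(v, ±Av)`, normalized to determinant one, `A` becomes the companion-type matrix `T`,
  -- whose entries are `0`, `±1` and the trace.
  · obtain ⟨x, y, q, hq, hq0⟩ : ∃ x y q : ℝ,
        q = x * (A 1 0 * x + A 1 1 * y) - y * (A 0 0 * x + A 0 1 * y) ∧ q ≠ 0 := by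
      by_cases hc : A 1 0 = 0
      · exact ⟨0, 1, -A 0 1, by ring, fun h => hdiag ⟨neg_eq_zero.mp h, hc⟩⟩
      · exact ⟨1, 0, A 1 0, by ring, hc⟩
    obtain ⟨ε, hε, hεq⟩ : ∃ ε : ℝ, (ε = 1 ∨ ε = -1) ∧ 0 < ε * q := by
      rcases lt_or_gt_of_ne hq0 with h | h
      · exact ⟨-1, Or.inr rfl, by linarith⟩
      · exact ⟨1, Or.inl rfl, by linarith⟩
    have hεε : ε * ε = 1 := by rcases hε with rfl | rfl <;> norm_num
    set s : ℝ := (Real.sqrt (ε * q))⁻¹ with hs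
    have hss : s * s * (ε * q) = 1 := by
      have h1 := Real.mul_self_sqrt hεq.le
      have h2 := (Real.sqrt_pos.mpr hεq).ne'
      rw [hs]
      field_simp
      nlinarith
    let h : H := ⟨!![s * x, ε * s * (A 0 0 * x + A 0 1 * y);
        s * y, ε * s * (A 1 0 * x + A 1 1 * y)], by
      rw [Matrix.det_fin_two_of]; linear_combination hss - s * s * ε * hq⟩
    let T : H := ⟨!![0, -ε; ε, A 0 0 + A 1 1], by
      rw [Matrix.det_fin_two_of]; linarith⟩
    have hconj : A * h = h * T := by
      ext i j
      rw [Matrix.SpecialLinearGroup.coe_mul, Matrix.SpecialLinearGroup.coe_mul,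
        Matrix.mul_apply, Matrix.mul_apply, Fin.sum_univ_two, Fin.sum_univ_two]
      fin_cases i <;> fin_cases j <;> simp [h, T]
      · linear_combination (-s * (A 0 0 * x + A 0 1 * y)) * hεε
      · linear_combination (-ε * s * x) * hdet
      · linear_combination (-s * (A 1 0 * x + A 1 1 * y)) * hεε
      · linear_combination (-ε * s * y) * hdet
    refine ⟨h, ?_⟩
    rw [mul_assoc, hconj, inv_mul_cancel_left]
    have hε1 : |ε| = 1 := by rcases hε with rfl | rfl <;> simp
    intro i j
    have := abs_nonneg (A 0 0 + A 1 1)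
    fin_cases i <;> fin_cases j <;> (simp [T, hε1]; try linarith)

section Lattice

variable {Γ : Type*} [Group Γ] {ι : Γ →* H}

/-- As the determinant is one, the eigenvalues are exactly `k` and `k⁻¹`. -/
theorem specRadius_eq_max (γ : Γ) {k : ℂ}
    (hk : k ∈ spectrum ℂ ((ι γ : Matrix (Fin 2) (Fin 2) ℝ).map Complex.ofReal)) :
    specRadius ι γ = max ‖k‖ ‖k‖⁻¹ := by
  have hk1 := (mem_spectrum_iff _ _).mp hk
  have hk0 : k ≠ 0 := by rintro rfl; simp at hk1
  have hinv : k⁻¹ ∈ spectrum ℂ ((ι γ : Matrix (Fin 2) (Fin 2) ℝ).map Complex.ofReal) := by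
    rw [mem_spectrum_iff]
    field_simp
    linear_combination hk1
  have hall : ∀ k' ∈ spectrum ℂ ((ι γ : Matrix (Fin 2) (Fin 2) ℝ).map Complex.ofReal),
      k' = k ∨ k' = k⁻¹ := by
    intro k' hk'
    rw [mem_spectrum_iff] at hk'
    have : (k' - k) * (k' * k - 1) = 0 := by linear_combination k * hk' - k' * hk1
    rcases mul_eq_zero.mp this with h | h
    · exact Or.inl (sub_eq_zero.mp h)
    · exact Or.inr (eq_inv_of_mul_eq_one_left (sub_eq_zero.mp h))
  have hr : spectralRadius ℂ ((ι γ : Matrix (Fin 2) (Fin 2) ℝ).map Complex.ofReal) =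
      ((max ‖k‖₊ ‖k‖₊⁻¹ : NNReal) : ENNReal) := by
    refine le_antisymm (iSup₂_le fun k' hk' => ?_) ?_
    · rcases hall k' hk' with rfl | rfl
      · exact ENNReal.coe_le_coe.mpr (le_max_left _ _)
      · rw [nnnorm_inv]
        exact ENNReal.coe_le_coe.mpr (le_max_right _ _)
    · rcases max_choice ‖k‖₊ ‖k‖₊⁻¹ with h | h <;> rw [h]
      · exact le_iSup₂ (f := fun k' (_ : k' ∈ spectrum ℂ _) => (‖k'‖₊ : ENNReal)) k hk
      · rw [← nnnorm_inv]
        exact le_iSup₂ (f := fun k' (_ : k' ∈ spectrum ℂ _) => (‖k'‖₊ : ENNReal)) k⁻¹ hinv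
  rw [specRadius, hr, ENNReal.coe_toReal]
  simp

theorem exists_mem_spectrum (γ : Γ) :
    ∃ k : ℂ, k ∈ spectrum ℂ ((ι γ : Matrix (Fin 2) (Fin 2) ℝ).map Complex.ofReal) := by
  obtain ⟨k, hk⟩ := spectrum.nonempty_of_isAlgClosed_of_finiteDimensional ℂ
    ((ι γ : Matrix (Fin 2) (Fin 2) ℝ).map Complex.ofReal)
  exact ⟨k, hk⟩

theorem one_le_specRadius (γ : Γ) : 1 ≤ specRadius ι γ := by
  obtain ⟨k, hk⟩ := exists_mem_spectrum (ι := ι) γ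
  rw [specRadius_eq_max γ hk]
  have hk1 := (mem_spectrum_iff _ _).mp hk
  have hk0 : k ≠ 0 := by rintro rfl; simp at hk1
  rcases le_total 1 ‖k‖ with h | h
  · exact h.trans (le_max_left _ _)
  · exact ((one_le_inv₀ (norm_pos_iff.mpr hk0)).mpr h).trans (le_max_right _ _)

theorem specRadius_pow (γ : Γ) (n : ℕ) : specRadius ι (γ ^ n) = specRadius ι γ ^ n := by
  obtain ⟨k, hk⟩ := exists_mem_spectrum (ι := ι) γ
  have hn : k ^ n ∈ spectrum ℂ
      ((ι (γ ^ n) : Matrix (Fin 2) (Fin 2) ℝ).map Complex.ofReal) := by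
    have h1 := spectrum.pow_mem_pow _ n hk
    have h2 : ((ι (γ ^ n) : Matrix (Fin 2) (Fin 2) ℝ).map Complex.ofReal) =
        ((ι γ : Matrix (Fin 2) (Fin 2) ℝ).map Complex.ofReal) ^ n := by
      rw [map_pow, Matrix.SpecialLinearGroup.coe_pow]
      exact map_pow (Complex.ofRealHom.mapMatrix) _ n
    rwa [h2]
  rw [specRadius_eq_max _ hk, specRadius_eq_max _ hn, norm_pow]
  rcases le_total ‖k‖ ‖k‖⁻¹ with h | h
  · have h' := pow_le_pow_left₀ (norm_nonneg k) h n
    rw [max_eq_right h, inv_pow, max_eq_right (by rwa [inv_pow] at h')]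
  · have h' := pow_le_pow_left₀ (inv_nonneg.mpr (norm_nonneg k)) h n
    rw [max_eq_left h, max_eq_left (by rwa [inv_pow] at h')]

/-- The trace is `k + k⁻¹` and one of the two terms has modulus at most one. Trace and spectral
radius are thus interchangeable up to constants, with no distinction between elliptic, parabolic and
hyperbolic elements. -/
theorem trace_specRadius (γ : Γ) :
    |ι γ 0 0 + ι γ 1 1| ≤ 2 * specRadius ι γ ∧
      specRadius ι γ ≤ |ι γ 0 0 + ι γ 1 1| + 1 := by
  obtain ⟨k, hk⟩ := exists_mem_spectrum (ι := ι) γ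
  have hk1 := (mem_spectrum_iff _ _).mp hk
  have hk0 : k ≠ 0 := by rintro rfl; simp at hk1
  have htr : ((ι γ 0 0 + ι γ 1 1 : ℝ) : ℂ) = k + k⁻¹ := by
    field_simp
    linear_combination -hk1
  have habs : |ι γ 0 0 + ι γ 1 1| = ‖k + k⁻¹‖ := by
    rw [← htr, Complex.norm_real, Real.norm_eq_abs]
  rw [habs, specRadius_eq_max γ hk]
  have e := norm_inv k
  have h1 := norm_add_le k k⁻¹
  have h2 : ‖k‖ ≤ ‖k + k⁻¹‖ + ‖k⁻¹‖ := norm_le_add_norm_add k k⁻¹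
  have h3 : ‖k⁻¹‖ ≤ ‖k + k⁻¹‖ + ‖k‖ := by
    have := norm_le_add_norm_add k⁻¹ k
    rwa [add_comm k⁻¹] at this
  rw [e] at h1 h2 h3
  have h4 := le_max_left ‖k‖ ‖k‖⁻¹
  have h5 := le_max_right ‖k‖ ‖k‖⁻¹
  refine ⟨by linarith, ?_⟩
  rcases le_total 1 ‖k‖ with h | h
  · have h6 : ‖k‖⁻¹ ≤ 1 := inv_le_one_of_one_le₀ h
    rw [max_eq_left (h6.trans h)]; linarith
  · have h6 : 1 ≤ ‖k‖⁻¹ := (one_le_inv₀ (norm_pos_iff.mpr hk0)).mpr h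
    rw [max_eq_right (h.trans h6)]; linarith

theorem specRadius_le_of_entry_le (γ : Γ) {C : ℝ} (hC : ∀ i j, |ι γ i j| ≤ C) :
    specRadius ι γ ≤ 2 * C + 1 := by
  have h1 := (trace_specRadius (ι := ι) γ).2
  have h2 := abs_add_le (ι γ 0 0) (ι γ 1 1)
  linarith [hC 0 0, hC 1 1]

theorem exists_entry_bound {K : Set H} (hK : IsCompact K) :
    ∃ B : ℝ, 1 ≤ B ∧ ∀ k ∈ K, ∀ i j, |k i j| ≤ B ∧ |k⁻¹ i j| ≤ B := by
  have hc : Continuous fun k : H => ∑ i, ∑ j, (|k i j| + |k⁻¹ i j|) := by fun_prop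
  obtain ⟨B, hB⟩ := hK.exists_bound_of_continuousOn hc.continuousOn
  refine ⟨max B 1, le_max_right _ _, fun k hk i j => ?_⟩
  have h1 := (le_abs_self _).trans (hB k hk)
  have h2 : |k i j| + |k⁻¹ i j| ≤ ∑ i, ∑ j, (|k i j| + |k⁻¹ i j|) := by
    refine (Finset.single_le_sum (f := fun j => |k i j| + |k⁻¹ i j|)
      (fun j _ => by positivity) (Finset.mem_univ j)).trans ?_
    exact Finset.single_le_sum (f := fun i => ∑ j, (|k i j| + |k⁻¹ i j|))
      (fun i _ => by positivity) (Finset.mem_univ i)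
  have h3 := abs_nonneg (k i j)
  have h4 := abs_nonneg (k⁻¹ i j)
  have h5 := le_max_left B 1
  constructor <;> linarith

/-- In a cocompact lattice, every element has a conjugate of norm comparable to its spectral
radius. -/
theorem exists_conj_entry_le_specRadius (hι : IsClosedSurfaceEmbedding ι) :
    ∃ C : ℝ, 1 ≤ C ∧ ∀ γ : Γ, ∃ δ : Γ, ∀ i j, |ι (δ⁻¹ * γ * δ) i j| ≤ C * specRadius ι γ := by
  obtain ⟨K, hK, hcov⟩ := exists_isCompact_cover hι
  obtain ⟨B, hB1, hB⟩ := exists_entry_bound hK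
  refine ⟨2 * (B * (2 * (3 * B))), by nlinarith, fun γ => ?_⟩
  obtain ⟨h, hh⟩ := exists_conj_entry_le (ι γ)
  -- The good conjugator `h` lies only in `H`; cocompactness replaces it by a lattice element at the
  -- cost of conjugating by the bounded factor `k`.
  obtain ⟨δ, k, hk, e⟩ := hcov h
  have h3 : ∀ i j, |(h⁻¹ * ι γ * h) i j| ≤ 3 * specRadius ι γ := fun i j => by
    linarith [hh i j, (trace_specRadius (ι := ι) γ).1, one_le_specRadius (ι := ι) γ]
  refine ⟨δ, fun i j => ?_⟩
  have e2 : ι (δ⁻¹ * γ * δ) = k * ((h⁻¹ * ι γ * h) * k⁻¹) := by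
    rw [e]; simp [mul_assoc]
  rw [e2, Matrix.SpecialLinearGroup.coe_mul, Matrix.SpecialLinearGroup.coe_mul]
  refine (entry_mul_le (fun i j => (hB k hk i j).1)
    (entry_mul_le h3 (fun i j => (hB k hk i j).2)) i j).trans (le_of_eq (by ring))

theorem transLength_nonneg (γ : Γ) : 0 ≤ transLength ι γ :=
  mul_nonneg zero_le_two (Real.log_nonneg (one_le_specRadius γ))

theorem transLength_pow (γ : Γ) (n : ℕ) : transLength ι (γ ^ n) = n * transLength ι γ := by
  rw [transLength, specRadius_pow, Real.log_pow, transLength]; ring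

/-- Up to conjugation and a bounded error, the translation length is subadditive. -/
theorem exists_transLength_mul_le (hι : IsClosedSurfaceEmbedding ι) :
    ∃ C : ℝ, ∀ γ γ' : Γ, ∃ δ δ' : Γ, transLength ι ((δ⁻¹ * γ * δ) * (δ'⁻¹ * γ' * δ')) ≤
      transLength ι γ + transLength ι γ' + C := by
  obtain ⟨C, hC1, hC⟩ := exists_conj_entry_le_specRadius hι
  refine ⟨2 * Real.log (4 * C * C + 1), fun γ γ' => ?_⟩
  obtain ⟨δ, hδ⟩ := hC γ
  obtain ⟨δ', hδ'⟩ := hC γ'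
  refine ⟨δ, δ', ?_⟩
  have h1 := one_le_specRadius (ι := ι) γ
  have h2 := one_le_specRadius (ι := ι) γ'
  have h12 : 1 ≤ specRadius ι γ * specRadius ι γ' := one_le_mul_of_one_le_of_one_le h1 h2
  have hr := specRadius_le_of_entry_le (ι := ι) ((δ⁻¹ * γ * δ) * (δ'⁻¹ * γ' * δ'))
    (C := 2 * (C * specRadius ι γ * (C * specRadius ι γ'))) (fun i j => by
      rw [map_mul ι, Matrix.SpecialLinearGroup.coe_mul]
      exact entry_mul_le hδ hδ' i j)
  have hlog := Real.log_le_log (lt_of_lt_of_le one_pos (one_le_specRadius _))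
    (hr.trans (show _ ≤ specRadius ι γ * specRadius ι γ' * (4 * C * C + 1) by nlinarith))
  rw [Real.log_mul (by positivity) (by positivity), Real.log_mul (by positivity)
    (by positivity)] at hlog
  simp only [transLength]
  linarith

end Lattice

/-! ### The stable norm as a supremum of periods over translation lengths -/

section StableNorm

variable {Γ : Type*} [Group Γ] {ι : Γ →* H}

theorem exists_representative (c : H1Int Γ) :
    ∃ γ : Γ, Additive.ofMul (Abelianization.of γ) = c := by
  obtain ⟨γ, hγ⟩ := QuotientGroup.mk_surjective (Additive.toMul c)
  exact ⟨γ, congrArg Additive.ofMul hγ⟩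

theorem bddBelow_classLength (n : ℕ) (c : H1Int Γ) :
    BddBelow {x | ∃ γ : Γ, Additive.ofMul (Abelianization.of γ) = n • c ∧
      x = transLength ι γ / n} := by
  refine ⟨0, ?_⟩
  rintro x ⟨γ, -, rfl⟩
  exact div_nonneg (transLength_nonneg γ) (Nat.cast_nonneg n)

theorem classLength_le {n : ℕ} {c : H1Int Γ} {γ : Γ}
    (hγ : Additive.ofMul (Abelianization.of γ) = n • c) :
    classLength ι n c ≤ transLength ι γ / n :=
  csInf_le (bddBelow_classLength n c) ⟨γ, hγ, rfl⟩

theorem exists_lt_classLength_add {n : ℕ} (c : H1Int Γ) {ε : ℝ} (hε : 0 < ε) :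
    ∃ γ : Γ, Additive.ofMul (Abelianization.of γ) = n • c ∧
      transLength ι γ / n < classLength ι n c + ε := by
  obtain ⟨γ, hγ⟩ := exists_representative (n • c)
  have hne : {x | ∃ γ : Γ, Additive.ofMul (Abelianization.of γ) = n • c ∧
      x = transLength ι γ / n}.Nonempty := ⟨_, γ, hγ, rfl⟩
  obtain ⟨_, ⟨γ, hγ, rfl⟩, h⟩ := exists_lt_of_csInf_lt hne
    (show classLength ι n c < classLength ι n c + ε by linarith)
  exact ⟨γ, hγ, h⟩

theorem classLength_nonneg (n : ℕ) (c : H1Int Γ) : 0 ≤ classLength ι n c := by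
  refine Real.sInf_nonneg ?_
  rintro x ⟨γ, -, rfl⟩
  exact div_nonneg (transLength_nonneg γ) (Nat.cast_nonneg n)

theorem of_conj (γ δ : Γ) : Abelianization.of (δ⁻¹ * γ * δ) = Abelianization.of γ := by
  simp [mul_comm]

/-- Conjugation does not change the homology class, so near-optimal representatives of `mc` and `nc`
may be conjugated before they are multiplied. Adding the constant to the sequence absorbs the
bounded error. -/
theorem exists_subadditive_classLength (hι : IsClosedSurfaceEmbedding ι) (c : H1Int Γ) :
    ∃ C : ℝ, Subadditive fun n : ℕ => n * classLength ι n c + C := by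
  obtain ⟨C₀, hC₀⟩ := exists_transLength_mul_le hι
  -- Nonnegativity is what the inequality needs when `m = 0` or `n = 0`.
  set C := max C₀ 0
  refine ⟨C, fun m n => ?_⟩
  have hC : 0 ≤ C := le_max_right _ _
  rcases Nat.eq_zero_or_pos m with rfl | hm
  · simpa using hC
  rcases Nat.eq_zero_or_pos n with rfl | hn
  · simpa using hC
  refine le_of_forall_pos_le_add fun ε hε => ?_
  have hm' : (0 : ℝ) < m := Nat.cast_pos.mpr hm
  have hn' : (0 : ℝ) < n := Nat.cast_pos.mpr hn
  obtain ⟨γ, hγ, h1⟩ := exists_lt_classLength_add (ι := ι) (n := m) c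
    (div_pos (half_pos hε) hm')
  obtain ⟨γ', hγ', h2⟩ := exists_lt_classLength_add (ι := ι) (n := n) c
    (div_pos (half_pos hε) hn')
  obtain ⟨δ, δ', h3⟩ := hC₀ γ γ'
  have hrep : Additive.ofMul (Abelianization.of ((δ⁻¹ * γ * δ) * (δ'⁻¹ * γ' * δ'))) =
      (m + n) • c := by
    rw [map_mul, of_conj, of_conj, ofMul_mul, hγ, hγ', add_smul]
  have h4 := classLength_le (ι := ι) hrep
  have hmn : (0 : ℝ) < ((m + n : ℕ) : ℝ) := Nat.cast_pos.mpr (by omega)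
  rw [le_div_iff₀ hmn] at h4
  rw [div_lt_iff₀ hm', add_mul, div_mul_cancel₀ _ hm'.ne'] at h1
  rw [div_lt_iff₀ hn', add_mul, div_mul_cancel₀ _ hn'.ne'] at h2
  have h5 : C₀ ≤ C := le_max_left _ _
  linarith

/-- Fekete's lemma for the corrected sequence; the correction `C / n` tends to zero. This makes the
`limUnder` in `stableNormInt` a genuine limit. -/
theorem tendsto_classLength (hι : IsClosedSurfaceEmbedding ι) (c : H1Int Γ) :
    Tendsto (fun n : ℕ => classLength ι n c) atTop (𝓝 (stableNormInt ι c)) := by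
  obtain ⟨C, hC⟩ := exists_subadditive_classLength hι c
  refine tendsto_nhds_limUnder ⟨hC.lim, ?_⟩
  have hb : BddBelow (Set.range fun n : ℕ => (n * classLength ι n c + C) / n) := by
    refine ⟨-|C|, ?_⟩
    rintro _ ⟨n, rfl⟩
    simp only
    rcases Nat.eq_zero_or_pos n with rfl | hn
    · simp
    have hn' : (1 : ℝ) ≤ n := by exact_mod_cast hn
    rw [le_div_iff₀ (by linarith)]
    have h1 := mul_nonneg (Nat.cast_nonneg (α := ℝ) n) (classLength_nonneg (ι := ι) n c)
    have h2 := neg_abs_le C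
    nlinarith [abs_nonneg C]
  have h1 := hC.tendsto_lim hb
  have h2 : Tendsto (fun n : ℕ => C / n) atTop (𝓝 0) := tendsto_const_div_atTop_nhds_zero_nat C
  have h3 := h1.sub h2
  rw [sub_zero] at h3
  refine h3.congr' ?_
  filter_upwards [eventually_gt_atTop 0] with n hn
  have hn' : (n : ℝ) ≠ 0 := by positivity
  field_simp
  ring

theorem stableNormInt_nonneg (hι : IsClosedSurfaceEmbedding ι) (c : H1Int Γ) :
    0 ≤ stableNormInt ι c :=
  ge_of_tendsto' (tendsto_classLength hι c) fun n => classLength_nonneg n c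

theorem stableNormInt_le_transLength (hι : IsClosedSurfaceEmbedding ι) (γ : Γ) :
    stableNormInt ι (Additive.ofMul (Abelianization.of γ)) ≤ transLength ι γ := by
  refine le_of_tendsto (tendsto_classLength hι _) ?_
  filter_upwards [eventually_gt_atTop 0] with n hn
  have hn' : (n : ℝ) ≠ 0 := by positivity
  refine (classLength_le (γ := γ ^ n) (by rw [map_pow, ofMul_pow])).trans (le_of_eq ?_)
  rw [transLength_pow]
  field_simp

theorem pairing_tmul (u : Γ →* Multiplicative ℝ) (a : ℝ) (γ : Γ) :
    pairing u (a ⊗ₜ[ℤ] Additive.ofMul (Abelianization.of γ)) = a * (u γ).toAdd := by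
  simp [pairing]

/-- A representative `γ` of `n[δ]` satisfies `u(γ) = n u(δ)`, so the hypothesis at `γ`, divided by
`n`, bounds `u(δ)` by `κ` times a near-optimal value of `t(γ)/n`. -/
theorem abs_pairing_le_stableNormInt (hι : IsClosedSurfaceEmbedding ι)
    {u : Γ →* Multiplicative ℝ} {κ : ℝ} (hκ : 0 ≤ κ)
    (hu : ∀ γ, |(u γ).toAdd| ≤ κ * transLength ι γ) (a : ℝ) (c : H1Int Γ) :
    |pairing u (a ⊗ₜ[ℤ] c)| ≤ κ * (|a| * stableNormInt ι c) := by
  obtain ⟨δ, rfl⟩ := exists_representative c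
  rw [pairing_tmul, abs_mul]
  suffices h : |(u δ).toAdd| ≤ κ * stableNormInt ι (Additive.ofMul (Abelianization.of δ)) by
    nlinarith [mul_le_mul_of_nonneg_left h (abs_nonneg a)]
  refine ge_of_tendsto ((tendsto_classLength hι _).const_mul κ) ?_
  filter_upwards [eventually_gt_atTop 0] with n hn
  have hn' : (0 : ℝ) < n := Nat.cast_pos.mpr hn
  refine le_of_forall_pos_le_add fun ε hε => ?_
  obtain ⟨γ, hγ, h1⟩ := exists_lt_classLength_add (ι := ι) (n := n)
    -- The denominator `κ + 1` keeps `κ` times the error below `ε` and allows `κ = 0`.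
    (Additive.ofMul (Abelianization.of δ)) (ε := ε / (κ + 1)) (by positivity)
  have h2 : (u γ).toAdd = n * (u δ).toAdd := by
    have h3 := pairing_tmul u 1 γ
    rw [hγ, ← ofMul_pow, ← map_pow, pairing_tmul, map_pow, toAdd_pow] at h3
    simpa using h3.symm
  have h3 := hu γ
  rw [h2, abs_mul, Nat.abs_cast] at h3
  have h4 : |(u δ).toAdd| ≤ κ * (transLength ι γ / n) := by
    rw [← mul_div_assoc, le_div_iff₀ hn']; linarith
  have h5 := mul_le_mul_of_nonneg_left h1.le hκ
  have h6 : κ * (ε / (κ + 1)) ≤ ε := by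
    rw [← mul_div_assoc, div_le_iff₀ (by linarith)]; nlinarith
  linarith

theorem exists_finsupp_sum_tmul (c : H1Real Γ) :
    ∃ l : H1Int Γ →₀ ℝ, (l.sum fun e a => a ⊗ₜ[ℤ] e) = c := by
  induction c using TensorProduct.induction_on with
  | zero => exact ⟨0, Finsupp.sum_zero_index⟩
  | tmul a e => exact ⟨Finsupp.single e a, by rw [Finsupp.sum_single_index (by simp)]⟩
  | add x y hx hy =>
    obtain ⟨l, rfl⟩ := hx
    obtain ⟨l', rfl⟩ := hy
    exact ⟨l + l', Finsupp.sum_add_index' (by simp) (by simp [TensorProduct.add_tmul])⟩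

theorem bddBelow_stableNormReal (hι : IsClosedSurfaceEmbedding ι) (c : H1Real Γ) :
    BddBelow {x | ∃ l : H1Int Γ →₀ ℝ, (l.sum fun e a => a ⊗ₜ[ℤ] e) = c ∧
      x = l.sum fun e a => |a| * stableNormInt ι e} := by
  refine ⟨0, ?_⟩
  rintro x ⟨l, -, rfl⟩
  exact Finset.sum_nonneg fun e _ => mul_nonneg (abs_nonneg _) (stableNormInt_nonneg hι e)

theorem abs_pairing_le_stableNormReal (hι : IsClosedSurfaceEmbedding ι)
    {u : Γ →* Multiplicative ℝ} {κ : ℝ} (hκ : 0 < κ)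
    (hu : ∀ γ, |(u γ).toAdd| ≤ κ * transLength ι γ) (c : H1Real Γ) :
    |pairing u c| ≤ κ * stableNormReal ι c := by
  rw [mul_comm, ← div_le_iff₀ hκ]
  obtain ⟨l, hl⟩ := exists_finsupp_sum_tmul c
  refine le_csInf ⟨_, l, hl, rfl⟩ ?_
  rintro x ⟨l, rfl, rfl⟩
  rw [div_le_iff₀ hκ, mul_comm, Finsupp.sum, Finsupp.sum, map_sum, Finset.mul_sum]
  exact (Finset.abs_sum_le_sum_abs _ _).trans
    (Finset.sum_le_sum fun e _ => abs_pairing_le_stableNormInt hι hκ.le hu _ _)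

theorem stableNormReal_tmul_le (hι : IsClosedSurfaceEmbedding ι) (a : ℝ) (γ : Γ) :
    stableNormReal ι (a ⊗ₜ[ℤ] Additive.ofMul (Abelianization.of γ)) ≤
      |a| * transLength ι γ := by
  refine (csInf_le (bddBelow_stableNormReal hι _)
    ⟨Finsupp.single _ a, Finsupp.sum_single_index (by simp), rfl⟩).trans ?_
  rw [Finsupp.sum_single_index (by simp)]
  exact mul_le_mul_of_nonneg_left (stableNormInt_le_transLength hι γ) (abs_nonneg a)

/-- The stable norm of `u` is less than `1/2` if and only if `|u(γ)| ≤ κ t(γ)` for some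
`κ < 1/2`. -/
theorem stableNorm_lt_half_iff (hι : IsClosedSurfaceEmbedding ι) (u : Γ →* Multiplicative ℝ) :
    stableNorm ι u < 1 / 2 ↔
      ∃ κ : ℝ, 0 < κ ∧ κ < 1 / 2 ∧ ∀ γ, |(u γ).toAdd| ≤ κ * transLength ι γ := by
  have hhalf : (1 / 2 : ENNReal) = ENNReal.ofReal (1 / 2) := by
    rw [ENNReal.ofReal_div_of_pos two_pos]; simp
  constructor
  · intro h
    obtain ⟨r, hr1, hr2⟩ := exists_between h
    have hrt : r ≠ ⊤ := (hr2.trans_le le_top).ne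
    have hr0 : 0 < r := lt_of_le_of_lt zero_le hr1
    have hκ0 : 0 < r.toReal := ENNReal.toReal_pos hr0.ne' hrt
    have hle : ∀ c : H1Real Γ, stableNormReal ι c ≤ 1 → |pairing u c| ≤ r.toReal := by
      intro c hc
      have h1 : ENNReal.ofReal |pairing u c| ≤ r :=
        (le_iSup₂ (f := fun (c : H1Real Γ) (_ : stableNormReal ι c ≤ 1) =>
          ENNReal.ofReal |pairing u c|) c hc).trans hr1.le
      exact (ENNReal.ofReal_le_iff_le_toReal hrt).mp h1
    refine ⟨r.toReal, hκ0, ?_, fun γ => ?_⟩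
    · rw [hhalf] at hr2
      have := (ENNReal.lt_ofReal_iff_toReal_lt hrt).mp hr2
      exact this
    -- The dual norm is tested on `a ⊗ [γ]`, whose stable norm is at most `a t(γ)`. If `t(γ) = 0`
    -- every `a` is allowed, forcing `u(γ) = 0`; otherwise `a = 1/t(γ)` is taken.
    · have key : ∀ a : ℝ, 0 ≤ a → a * transLength ι γ ≤ 1 → a * |(u γ).toAdd| ≤ r.toReal := by
        intro a ha h1
        have h2 := hle (a ⊗ₜ[ℤ] Additive.ofMul (Abelianization.of γ))
          ((stableNormReal_tmul_le hι a γ).trans (by rwa [abs_of_nonneg ha]))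
        rwa [pairing_tmul, abs_mul, abs_of_nonneg ha] at h2
      rcases (transLength_nonneg (ι := ι) γ).eq_or_lt with h0 | h0
      · rw [← h0, mul_zero]
        by_contra hcon
        push Not at hcon
        have := key (2 * r.toReal / |(u γ).toAdd|) (by positivity) (by rw [← h0]; simp)
        rw [div_mul_cancel₀ _ hcon.ne'] at this
        linarith
      · have := key (transLength ι γ)⁻¹ (by positivity) (by rw [inv_mul_cancel₀ h0.ne'])
        rwa [inv_mul_le_iff₀ h0, mul_comm] at this
  · rintro ⟨κ, hκ0, hκ, hu⟩
    refine lt_of_le_of_lt (b := ENNReal.ofReal κ) ?_ ?_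
    · refine iSup₂_le fun c hc => ENNReal.ofReal_le_ofReal ?_
      exact (abs_pairing_le_stableNormReal hι hκ0 hu c).trans (by nlinarith)
    · rw [hhalf]
      exact (ENNReal.ofReal_lt_ofReal_iff (by norm_num)).mpr hκ

end StableNorm

/-! ### Frames given by invertible matrices -/

/-- The vectors whose coordinates in the basis of columns of `F` vanish outside `S`. -/
def coordSubspace (F : Matrix (Fin 3) (Fin 3) ℝ) (S : Set (Fin 3)) : Submodule ℝ V where
  carrier := {w | ∀ i ∉ S, F⁻¹.mulVec w i = 0}
  add_mem' hv hw i hi := by rw [Matrix.mulVec_add, Pi.add_apply, hv i hi, hw i hi, add_zero]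
  zero_mem' i _ := by rw [Matrix.mulVec_zero]; rfl
  smul_mem' c v hv i hi := by rw [Matrix.mulVec_smul, Pi.smul_apply, hv i hi, smul_zero]

theorem col_ne_zero {F : Matrix (Fin 3) (Fin 3) ℝ} (hF : F.det ≠ 0) (j : Fin 3) : Fᵀ j ≠ 0 := by
  intro h
  exact hF (Matrix.det_eq_zero_of_column_eq_zero j fun i => congrFun h i)

/-- The frame of the lines spanned by the columns of `F`. -/
def frameOf (F : Matrix (Fin 3) (Fin 3) ℝ) (hF : F.det ≠ 0) : Frame :=
  ⟨fun j => Projectivization.mk ℝ (Fᵀ j) (col_ne_zero hF j), by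
    refine Projectivization.Independent.mk _ (col_ne_zero hF) ?_
    exact Matrix.linearIndependent_cols_iff_isUnit.mpr
      ((Matrix.isUnit_iff_isUnit_det F).mpr hF.isUnit)⟩

theorem det_coe_mul_ne_zero (g : G) {F : Matrix (Fin 3) (Fin 3) ℝ} (hF : F.det ≠ 0) :
    (g.1 * F).det ≠ 0 := by
  rw [Matrix.det_mul, g.2, one_mul]; exact hF

theorem smul_frameOf (g : G) {F : Matrix (Fin 3) (Fin 3) ℝ} (hF : F.det ≠ 0) :
    g • frameOf F hF = frameOf (g.1 * F) (det_coe_mul_ne_zero g hF) := by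
  refine Subtype.ext (funext fun j => ?_)
  change g • Projectivization.mk ℝ (Fᵀ j) _ = Projectivization.mk ℝ ((g.1 * F)ᵀ j) _
  rw [Projectivization.smul_mk]
  congr 1

theorem frameOf_mul_diagonal {F F' : Matrix (Fin 3) (Fin 3) ℝ} {d : Fin 3 → ℝ}
    (h : F' = F * Matrix.diagonal d) (hF : F.det ≠ 0) (hF' : F'.det ≠ 0) :
    frameOf F' hF' = frameOf F hF := by
  refine Subtype.ext (funext fun j => ?_)
  refine (Projectivization.mk_eq_mk_iff' ℝ _ _ _ _).mpr ⟨d j, ?_⟩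
  ext i
  rw [h]
  simp [Matrix.mul_diagonal, mul_comm]

/-- Every frame is given by a matrix with unit columns. -/
theorem exists_eq_frameOf (y : Frame) : ∃ (F : Matrix (Fin 3) (Fin 3) ℝ) (hF : F.det ≠ 0),
    y = frameOf F hF ∧ ∀ j, ∑ i, F i j ^ 2 = 1 := by
  have hli := (Projectivization.independent_iff).mp y.2
  set F₀ : Matrix (Fin 3) (Fin 3) ℝ := (Matrix.of fun j => (y.1 j).rep)ᵀ with hF₀
  have hdet : F₀.det ≠ 0 := by
    have : LinearIndependent ℝ F₀.col := hli
    exact ((Matrix.isUnit_iff_isUnit_det _).mp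
      (Matrix.linearIndependent_cols_iff_isUnit.mp this)).ne_zero
  have hpos : ∀ j, 0 < ∑ i, F₀ i j ^ 2 := by
    intro j
    obtain ⟨i, hi⟩ := Function.ne_iff.mp (y.1 j).rep_nonzero
    have hi' : F₀ i j ≠ 0 := hi
    exact Finset.sum_pos' (fun i _ => sq_nonneg _) ⟨i, Finset.mem_univ i, by positivity⟩
  have hd : ∀ j, (Real.sqrt (∑ i, F₀ i j ^ 2))⁻¹ ≠ 0 := fun j =>
    inv_ne_zero (Real.sqrt_pos.mpr (hpos j)).ne'
  have hdet' : (F₀ * Matrix.diagonal fun j => (Real.sqrt (∑ i, F₀ i j ^ 2))⁻¹).det ≠ 0 := by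
    rw [Matrix.det_mul, Matrix.det_diagonal]
    exact mul_ne_zero hdet (Finset.prod_ne_zero_iff.mpr fun j _ => hd j)
  refine ⟨_, hdet', ?_, fun j => ?_⟩
  · rw [frameOf_mul_diagonal rfl hdet]
    refine Subtype.ext (funext fun j => ?_)
    exact ((y.1 j).mk_rep).symm
  · simp only [Matrix.mul_diagonal, mul_pow]
    rw [← Finset.sum_mul, inv_pow, Real.sq_sqrt (hpos j).le, mul_inv_cancel₀ (hpos j).ne']

/-! ### Isotropy algebras in the basis of a frame -/

section Isotropy

variable {F : Matrix (Fin 3) (Fin 3) ℝ}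

theorem inv_mulVec_col (hF : F.det ≠ 0) (j : Fin 3) : F⁻¹.mulVec (Fᵀ j) = Pi.single j 1 := by
  have h : Fᵀ j = F.mulVec (Pi.single j 1) := by
    rw [Matrix.mulVec_single_one]; rfl
  rw [h, Matrix.mulVec_mulVec, Matrix.nonsing_inv_mul F hF.isUnit, Matrix.one_mulVec]

theorem eq_sum_smul_col (hF : F.det ≠ 0) (w : V) : w = ∑ j, F⁻¹.mulVec w j • Fᵀ j := by
  have h : w = F.mulVec (F⁻¹.mulVec w) := by
    rw [Matrix.mulVec_mulVec, Matrix.mul_nonsing_inv F hF.isUnit, Matrix.one_mulVec]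
  conv_lhs => rw [h]
  ext i
  simp [Matrix.mulVec, dotProduct, mul_comm]

theorem span_col_eq (hF : F.det ≠ 0) (j : Fin 3) : (ℝ ∙ Fᵀ j) = coordSubspace F {j} := by
  apply le_antisymm
  · rw [Submodule.span_singleton_le_iff_mem]
    intro i hi
    rw [inv_mulVec_col hF, Pi.single_eq_of_ne hi]
  · intro w hw
    rw [eq_sum_smul_col hF w]
    refine Submodule.sum_mem _ fun i _ => ?_
    by_cases hi : i = j
    · subst hi; exact Submodule.smul_mem _ _ (Submodule.mem_span_singleton_self _)
    · rw [hw i hi, zero_smul]; exact Submodule.zero_mem _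

theorem span_col_sup_eq (hF : F.det ≠ 0) (j k : Fin 3) :
    (ℝ ∙ Fᵀ j) ⊔ (ℝ ∙ Fᵀ k) = coordSubspace F {j, k} := by
  apply le_antisymm
  · refine sup_le ?_ ?_ <;> rw [Submodule.span_singleton_le_iff_mem] <;> intro i hi <;>
      rw [inv_mulVec_col hF, Pi.single_eq_of_ne (by rintro rfl; simp at hi)]
  · intro w hw
    rw [eq_sum_smul_col hF w]
    refine Submodule.sum_mem _ fun i _ => ?_
    by_cases hi : i = j
    · subst hi
      exact Submodule.mem_sup_left (Submodule.smul_mem _ _ (Submodule.mem_span_singleton_self _))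
    by_cases hi' : i = k
    · subst hi'
      exact Submodule.mem_sup_right (Submodule.smul_mem _ _ (Submodule.mem_span_singleton_self _))
    · rw [hw i (by simp [hi, hi']), zero_smul]; exact Submodule.zero_mem _

/-- Conjugation by `F` reduces to coordinate subspaces, where invariance is a vanishing block. Hence
frame stabilizers become diagonal matrices, and the two flag stabilizers become upper and lower
triangular ones. -/
theorem mem_preserving_coordSubspace (hF : F.det ≠ 0) (S : Set (Fin 3)) (ξ : Matrix (Fin 3) (Fin 3) ℝ) :
    ξ ∈ preserving (coordSubspace F S) ↔ ∀ j ∈ S, ∀ i ∉ S, (F⁻¹ * ξ * F) i j = 0 := by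
  have key : ∀ w, F⁻¹.mulVec (ξ.mulVec w) = (F⁻¹ * ξ * F).mulVec (F⁻¹.mulVec w) := fun w => by
    rw [Matrix.mulVec_mulVec, Matrix.mulVec_mulVec, Matrix.mul_assoc (F⁻¹ * ξ),
      Matrix.mul_nonsing_inv F hF.isUnit, Matrix.mul_one]
  constructor
  · intro h j hj i hi
    have h1 : Fᵀ j ∈ coordSubspace F S := fun k hk => by
      rw [inv_mulVec_col hF, Pi.single_eq_of_ne (by rintro rfl; exact hk hj)]
    have h2 := h _ h1 i hi
    rw [key, inv_mulVec_col hF, Matrix.mulVec_single_one] at h2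
    exact h2
  · intro h w hw i hi
    rw [key, Matrix.mulVec, dotProduct]
    refine Finset.sum_eq_zero fun j _ => ?_
    by_cases hj : j ∈ S
    · rw [h j hj i hi, zero_mul]
    · rw [hw j hj, mul_zero]

theorem mem_isotropy_frameOf (hF : F.det ≠ 0) (ξ : Matrix (Fin 3) (Fin 3) ℝ) :
    ξ ∈ isotropy (frameOf F hF) ↔ ∀ i j, i ≠ j → (F⁻¹ * ξ * F) i j = 0 := by
  have h1 : ∀ j, ((frameOf F hF).1 j).submodule = coordSubspace F {j} := fun j =>
    (Projectivization.submodule_mk _ _).trans (span_col_eq hF j)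
  simp only [isotropy, Submodule.mem_iInf, h1, mem_preserving_coordSubspace hF]
  constructor
  · intro h i j hij
    exact h j j rfl i hij
  · rintro h j _ rfl i hi
    exact h i _ hi

theorem mem_flagIsotropy_piPlus (hF : F.det ≠ 0) (ξ : Matrix (Fin 3) (Fin 3) ℝ) :
    ξ ∈ flagIsotropy (piPlus (frameOf F hF)) ↔ ∀ i j, j < i → (F⁻¹ * ξ * F) i j = 0 := by
  have h1 : piPlus (frameOf F hF) = (coordSubspace F {0}, coordSubspace F {0, 1}) :=
    Prod.ext ((Projectivization.submodule_mk _ _).trans (span_col_eq hF 0))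
      ((congrArg₂ _ (Projectivization.submodule_mk _ _) (Projectivization.submodule_mk _ _)).trans
        (span_col_sup_eq hF 0 1))
  rw [h1, flagIsotropy, Submodule.mem_inf, mem_preserving_coordSubspace hF,
    mem_preserving_coordSubspace hF]
  constructor
  · rintro ⟨h, h'⟩ i j hij
    by_cases hj : j = 0
    · subst hj; exact h 0 rfl i hij.ne'
    · exact h' j (by fin_cases j <;> fin_cases i <;> simp_all) i
        (by fin_cases j <;> fin_cases i <;> simp_all)
  · intro h
    refine ⟨fun j hj i hi => h i j ?_, fun j hj i hi => h i j ?_⟩ <;>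
      fin_cases j <;> fin_cases i <;> simp_all

theorem mem_flagIsotropy_piMinus (hF : F.det ≠ 0) (ξ : Matrix (Fin 3) (Fin 3) ℝ) :
    ξ ∈ flagIsotropy (piMinus (frameOf F hF)) ↔ ∀ i j, i < j → (F⁻¹ * ξ * F) i j = 0 := by
  have h1 : piMinus (frameOf F hF) = (coordSubspace F {2}, coordSubspace F {2, 1}) :=
    Prod.ext ((Projectivization.submodule_mk _ _).trans (span_col_eq hF 2))
      ((congrArg₂ _ (Projectivization.submodule_mk _ _) (Projectivization.submodule_mk _ _)).trans
        (span_col_sup_eq hF 2 1))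
  rw [h1, flagIsotropy, Submodule.mem_inf, mem_preserving_coordSubspace hF,
    mem_preserving_coordSubspace hF]
  constructor
  · rintro ⟨h, h'⟩ i j hij
    by_cases hj : j = 2
    · subst hj; exact h 2 rfl i hij.ne
    · exact h' j (by fin_cases j <;> fin_cases i <;> simp_all) i
        (by fin_cases j <;> fin_cases i <;> simp_all)
  · intro h
    refine ⟨fun j hj i hi => h i j ?_, fun j hj i hi => h i j ?_⟩ <;>
      fin_cases j <;> fin_cases i <;> simp_all

end Isotropy

/-! ### Small stable norm implies the Anosov property -/

/-- The exponents of `a^{-t}` on `V`. -/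
def aWeight : Fin 3 → ℝ := ![-1, 0, 1]

/-- The exponents of `φ^{-s}` on `V`, up to scalars. -/
def phiWeight : Fin 3 → ℝ := ![0, 1, 0]

theorem rho0_aFlow (t : ℝ) :
    (rho0 (aFlow t)).1 = Matrix.diagonal fun i => Real.exp (-t * aWeight i) := by
  change rho0Matrix (aFlow t).1 = _
  ext i j
  fin_cases i <;> fin_cases j <;> simp [rho0Matrix, aFlow, aWeight]

theorem phi_eq_diagonal (s : ℝ) :
    (phi s).1 = Matrix.diagonal fun i => Real.exp (s / 3 - s * phiWeight i) := by
  ext i j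
  fin_cases i <;> fin_cases j <;> simp [phi, phiWeight]
  ring

theorem rho0_aFlow_inv (t : ℝ) : (rho0 (aFlow t))⁻¹ = rho0 (aFlow (-t)) := by
  rw [inv_eq_iff_mul_eq_one, ← map_mul, ← aFlow_add, add_neg_cancel, aFlow_zero, map_one]

theorem phi_inv (s : ℝ) : (phi s)⁻¹ = phi (-s) := by
  rw [inv_eq_iff_mul_eq_one, ← phi_add, add_neg_cancel, phi_zero]

/-- The scalar factor `e^{s/3}` of `φ^s` cancels under conjugation, so only `phiWeight` remains. -/
theorem phi_inv_conj_apply (s : ℝ) (ξ : Matrix (Fin 3) (Fin 3) ℝ) (i j : Fin 3) :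
    ((phi s)⁻¹.1 * ξ * (phi s).1) i j =
      Real.exp (s * (phiWeight i - phiWeight j)) * ξ i j := by
  rw [phi_inv, phi_eq_diagonal, phi_eq_diagonal, Matrix.mul_diagonal, Matrix.diagonal_mul,
    mul_right_comm, ← Real.exp_add]
  ring_nf

theorem aFlow_inv_conj_apply (t : ℝ) (ξ : Matrix (Fin 3) (Fin 3) ℝ) (i j : Fin 3) :
    ((rho0 (aFlow t))⁻¹.1 * ξ * (rho0 (aFlow t)).1) i j =
      Real.exp (t * (aWeight i - aWeight j)) * ξ i j := by
  rw [rho0_aFlow_inv, rho0_aFlow, rho0_aFlow, Matrix.mul_diagonal, Matrix.diagonal_mul,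
    mul_right_comm, ← Real.exp_add]
  ring_nf

theorem rho0_det_ne_zero (h : H) : (rho0 h).1.det ≠ 0 := by
  rw [(rho0 h).2]; exact one_ne_zero

/-- The frame `([ρ₀(h)e₁], [e₂], [ρ₀(h)e₃])`. -/
def stdFrame (h : H) : Frame := frameOf (rho0 h).1 (rho0_det_ne_zero h)

theorem stdFrame_mul_aFlow (h : H) (t : ℝ) : stdFrame (h * aFlow t) = stdFrame h := by
  refine frameOf_mul_diagonal (d := fun i => Real.exp (-t * aWeight i)) ?_ _ _
  rw [map_mul, Matrix.SpecialLinearGroup.coe_mul, rho0_aFlow]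

theorem continuous_rho0 : Continuous rho0 := by
  refine Topology.IsInducing.subtypeVal.continuous_iff.mpr ?_
  refine continuous_matrix fun i j => ?_
  change Continuous fun h : H => rho0Matrix h.1 i j
  fin_cases i <;> fin_cases j <;> simp [rho0Matrix] <;> fun_prop

theorem continuous_stdFrame : Continuous stdFrame := by
  refine Continuous.subtype_mk (continuous_pi fun j => ?_) _
  have h1 : Continuous (Projectivization.mk' ℝ : {v : V // v ≠ 0} → ℙ ℝ V) :=
    continuous_coinduced_rng
  have h2 : Continuous fun h : H => (rho0 h).1ᵀ j := by
    have : Continuous fun h : H => (rho0 h).1 :=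
      continuous_subtype_val.comp continuous_rho0
    fun_prop
  exact h1.comp (h2.subtype_mk fun h => col_ne_zero (rho0_det_ne_zero h) j)

/-- The sum of the absolute values of the entries. -/
def entrySum (ξ : Matrix (Fin 3) (Fin 3) ℝ) : ℝ := ∑ i, ∑ j, |ξ i j|

theorem abs_le_entrySum (ξ : Matrix (Fin 3) (Fin 3) ℝ) (i j : Fin 3) :
    |ξ i j| ≤ entrySum ξ :=
  (Finset.single_le_sum (f := fun j => |ξ i j|) (fun _ _ => abs_nonneg _)
    (Finset.mem_univ j)).trans (Finset.single_le_sum (f := fun i => ∑ j, |ξ i j|)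
      (fun _ _ => Finset.sum_nonneg fun _ _ => abs_nonneg _) (Finset.mem_univ i))

theorem entrySum_nonneg (ξ : Matrix (Fin 3) (Fin 3) ℝ) : 0 ≤ entrySum ξ :=
  (abs_nonneg _).trans (abs_le_entrySum ξ 0 0)

theorem entrySum_smul (c : ℝ) (ξ : Matrix (Fin 3) (Fin 3) ℝ) :
    entrySum (c • ξ) = |c| * entrySum ξ := by
  simp [entrySum, abs_mul, Finset.mul_sum]

theorem eq_zero_of_entrySum {ξ : Matrix (Fin 3) (Fin 3) ℝ} (h : entrySum ξ = 0) : ξ = 0 := by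
  ext i j
  exact abs_nonpos_iff.mp ((abs_le_entrySum ξ i j).trans h.le)

theorem entrySum_le_of_entry_le {ξ η : Matrix (Fin 3) (Fin 3) ℝ} {c : ℝ}
    (h : ∀ i j, |ξ i j| ≤ c * |η i j|) : entrySum ξ ≤ c * entrySum η := by
  simp only [entrySum, Finset.mul_sum]
  exact Finset.sum_le_sum fun i _ => Finset.sum_le_sum fun j _ => h i j

theorem continuous_entrySum : Continuous entrySum := by
  unfold entrySum
  fun_prop

/-- The unit sphere of the space of matrices with zero diagonal. -/
def offDiagSphere : Set (Matrix (Fin 3) (Fin 3) ℝ) :=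
  {ξ | entrySum ξ = 1 ∧ ∀ i, ξ i i = 0}

theorem isCompact_offDiagSphere : IsCompact offDiagSphere := by
  have hbox : IsCompact (X := Fin 3 → Fin 3 → ℝ)
      (Set.univ.pi fun _ => Set.univ.pi fun _ => Set.Icc (-1) 1) :=
    isCompact_univ_pi fun _ => isCompact_univ_pi fun _ => isCompact_Icc
  have hclosed : IsClosed offDiagSphere := by
    refine (isClosed_eq continuous_entrySum continuous_const).inter ?_
    have : {ξ : Matrix (Fin 3) (Fin 3) ℝ | ∀ i, ξ i i = 0} = ⋂ i, {ξ | ξ i i = 0} := by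
      ext; simp
    change IsClosed {ξ : Matrix (Fin 3) (Fin 3) ℝ | ∀ i, ξ i i = 0}
    rw [this]
    exact isClosed_iInter fun i => isClosed_eq (by fun_prop) continuous_const
  refine IsCompact.of_isClosed_subset (X := Matrix (Fin 3) (Fin 3) ℝ) hbox hclosed ?_
  rintro ξ ⟨hξ, -⟩ i - j -
  exact abs_le.mp ((abs_le_entrySum ξ i j).trans hξ.le)

/-! ### Vertical norms along the standard section -/

section Norms

variable {Γ : Type*} [Group Γ] {ι : Γ →* H} {ρ : Γ →* G}

/-- The norm of the vertical vector represented by `ξ`. -/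
def VerticalNorm.val (N : VerticalNorm ι ρ) (h : H) (y : Frame) (ξ : Matrix (Fin 3) (Fin 3) ℝ) :
    ℝ := N.toSeminorm h y ((isotropy y).mkQ ξ)

theorem VerticalNorm.val_nonneg (N : VerticalNorm ι ρ) (h : H) (y : Frame)
    (ξ : Matrix (Fin 3) (Fin 3) ℝ) : 0 ≤ N.val h y ξ := apply_nonneg _ _

/-- The norm over the standard section, in the coordinates given by `ρ₀(h)`. -/
def VerticalNorm.std (N : VerticalNorm ι ρ) (h : H) (ξ : Matrix (Fin 3) (Fin 3) ℝ) : ℝ :=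
  N.val h (stdFrame h) ((rho0 h).1 * ξ * (rho0 h)⁻¹.1)

theorem VerticalNorm.std_smul (N : VerticalNorm ι ρ) (h : H) (c : ℝ)
    (ξ : Matrix (Fin 3) (Fin 3) ℝ) : N.std h (c • ξ) = |c| * N.std h ξ := by
  simp only [VerticalNorm.std, VerticalNorm.val, Matrix.mul_smul, Matrix.smul_mul, map_smul]
  rw [map_smul_eq_mul, Real.norm_eq_abs]

theorem coe_inv_mul_cancel (g : G) : g⁻¹.1 * g.1 = 1 := by
  have := congrArg Subtype.val (inv_mul_cancel g)
  exact this

theorem coe_mul_inv_cancel (g : G) : g.1 * g⁻¹.1 = 1 := by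
  have := congrArg Subtype.val (mul_inv_cancel g)
  exact this

theorem coe_inv_eq (g : G) : g.1⁻¹ = g⁻¹.1 := Matrix.inv_eq_right_inv (coe_mul_inv_cancel g)

theorem inv_conj_conj (g : G) (ξ : Matrix (Fin 3) (Fin 3) ℝ) :
    g⁻¹.1 * (g.1 * ξ * g⁻¹.1) * g.1 = ξ := by
  rw [Matrix.mul_assoc g.1, ← Matrix.mul_assoc g⁻¹.1, coe_inv_mul_cancel, Matrix.one_mul,
    Matrix.mul_assoc, coe_inv_mul_cancel, Matrix.mul_one]

theorem conj_inv_conj (g : G) (ξ : Matrix (Fin 3) (Fin 3) ℝ) :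
    g.1 * (g⁻¹.1 * ξ * g.1) * g⁻¹.1 = ξ := by
  have := inv_conj_conj g⁻¹ ξ
  rwa [inv_inv] at this

/-- In the coordinates of the frame the isotropy consists of the diagonal matrices, so a nonzero
matrix with zero diagonal represents a nonzero tangent vector. -/
theorem VerticalNorm.std_pos (N : VerticalNorm ι ρ) (h : H) {ξ : Matrix (Fin 3) (Fin 3) ℝ}
    (hξ : ξ ∈ offDiagSphere) : 0 < N.std h ξ := by
  refine (N.val_nonneg _ _ _).lt_of_ne fun h0 => ?_
  have h1 := N.definite _ _ _ h0.symm
  rw [Submodule.mkQ_apply, Submodule.Quotient.mk_eq_zero, stdFrame, mem_isotropy_frameOf] at h1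
  rw [coe_inv_eq, inv_conj_conj] at h1
  have h2 : ξ = 0 := by
    ext i j
    by_cases hij : i = j
    · subst hij; exact hξ.2 i
    · exact h1 i j hij
  have h3 := hξ.1
  rw [h2] at h3
  simp [entrySum] at h3

theorem VerticalNorm.continuous_std (N : VerticalNorm ι ρ) :
    Continuous fun p : H × Matrix (Fin 3) (Fin 3) ℝ => N.std p.1 p.2 := by
  have h1 : Continuous fun h : H => (rho0 h).1 := continuous_subtype_val.comp continuous_rho0
  have h2 : Continuous fun h : H => (rho0 h)⁻¹.1 :=
    continuous_subtype_val.comp continuous_rho0.inv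
  have h3 : Continuous fun p : H × Matrix (Fin 3) (Fin 3) ℝ =>
      (p.1, stdFrame p.1, (rho0 p.1).1 * p.2 * (rho0 p.1)⁻¹.1) :=
    continuous_fst.prodMk ((continuous_stdFrame.comp continuous_fst).prodMk
      (((h1.comp continuous_fst).mul continuous_snd).mul (h2.comp continuous_fst)))
  exact N.continuous.comp h3

/-- A positive continuous function on `K` times the unit sphere is bounded above and away from zero;
homogeneity does the rest. -/
theorem VerticalNorm.exists_std_bounds (N : VerticalNorm ι ρ) {K : Set H} (hK : IsCompact K) :
    ∃ c > 0, ∃ C > 0, ∀ k ∈ K, ∀ ξ : Matrix (Fin 3) (Fin 3) ℝ, (∀ i, ξ i i = 0) →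
      c * entrySum ξ ≤ N.std k ξ ∧ N.std k ξ ≤ C * entrySum ξ := by
  have hKS := hK.prod isCompact_offDiagSphere
  obtain ⟨c, hc, hcK⟩ := hKS.exists_forall_le' N.continuous_std.continuousOn
    (a := 0) (fun p hp => N.std_pos p.1 hp.2)
  obtain ⟨C, hC⟩ := hKS.exists_bound_of_continuousOn N.continuous_std.continuousOn
  refine ⟨c, hc, max C 1, by positivity, fun k hk ξ hξ => ?_⟩
  rcases (entrySum_nonneg ξ).eq_or_lt with h0 | h0
  · have hξ0 := eq_zero_of_entrySum h0.symm
    have : N.std k ξ = 0 := by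
      have := N.std_smul k 0 ξ
      rwa [zero_smul, abs_zero, zero_mul, ← hξ0] at this
    rw [this, ← h0]
    simp
  · have hmem : (k, (entrySum ξ)⁻¹ • ξ) ∈ K ×ˢ offDiagSphere := by
      refine ⟨hk, ?_, fun i => ?_⟩
      · rw [entrySum_smul, abs_of_pos (inv_pos.mpr h0), inv_mul_cancel₀ h0.ne']
      · simp [hξ i]
    have h1 := hcK _ hmem
    have h2 := (le_abs_self _).trans ((hC _ hmem).trans (le_max_left C 1))
    simp only [VerticalNorm.std_smul, abs_of_pos (inv_pos.mpr h0)] at h1 h2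
    rw [inv_mul_le_iff₀ h0] at h2
    rw [le_inv_mul_iff₀ h0] at h1
    constructor <;> linarith

end Norms

/-! ### The standard section is Anosov when the periods are small -/

section SmallNorm

variable {Γ : Type*} [Group Γ] {ι : Γ →* H} {u : Γ →* Multiplicative ℝ}

theorem mul_conj (g g' : G) (ξ : Matrix (Fin 3) (Fin 3) ℝ) :
    (g * g').1 * ξ * (g * g')⁻¹.1 = g.1 * (g'.1 * ξ * g'⁻¹.1) * g⁻¹.1 := by
  rw [mul_inv_rev]
  change g.1 * g'.1 * ξ * (g'⁻¹.1 * g⁻¹.1) = _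
  simp only [Matrix.mul_assoc]

theorem linearDeformation_mul_rho0 (γ : Γ) (h : H) :
    linearDeformation ι u γ * rho0 h = rho0 (ι γ * h) * phi (u γ).toAdd := by
  change phi (u γ).toAdd * rho0 (ι γ) * rho0 h = _
  rw [mul_assoc, ← map_mul, phi_comm]

/-- The extra factor `φ^{u(γ)}` only rescales the columns of `ρ₀(ι(γ)h)`, so the same section works
for every `u`. -/
theorem linearDeformation_smul_stdFrame (γ : Γ) (h : H) :
    linearDeformation ι u γ • stdFrame h = stdFrame (ι γ * h) := by
  rw [stdFrame, smul_frameOf]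
  refine frameOf_mul_diagonal (d := fun i => Real.exp ((u γ).toAdd / 3 -
    (u γ).toAdd * phiWeight i)) ?_ _ _
  rw [← phi_eq_diagonal]
  exact congrArg Subtype.val (linearDeformation_mul_rho0 γ h)

/-- This is where `u` enters the estimate: although the section does not depend on it, returning to
a fundamental domain conjugates tangent vectors by `φ^{u(γ)}`. -/
theorem VerticalNorm.std_mul (N : VerticalNorm ι (linearDeformation ι u)) (γ : Γ) (h : H)
    (ξ : Matrix (Fin 3) (Fin 3) ℝ) :
    N.std (ι γ * h) ξ = N.std h ((phi (u γ).toAdd)⁻¹.1 * ξ * (phi (u γ).toAdd).1) := by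
  have h1 := N.invariant γ h (stdFrame h)
    ((rho0 h).1 * ((phi (u γ).toAdd)⁻¹.1 * ξ * (phi (u γ).toAdd).1) * (rho0 h)⁻¹.1)
  have h2 : (linearDeformation ι u γ).1 * ((rho0 h).1 *
      ((phi (u γ).toAdd)⁻¹.1 * ξ * (phi (u γ).toAdd).1) * (rho0 h)⁻¹.1) *
        (linearDeformation ι u γ)⁻¹.1 = (rho0 (ι γ * h)).1 * ξ * (rho0 (ι γ * h))⁻¹.1 := by
    rw [← mul_conj, linearDeformation_mul_rho0, mul_conj, conj_inv_conj]
  change N.val (ι γ * h) (linearDeformation ι u γ • stdFrame h) _ = N.std h _ at h1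
  rw [← h1, linearDeformation_smul_stdFrame, VerticalNorm.std]
  exact congrArg _ h2.symm

/-- The section `h ↦ ([ρ₀(h)e₁], [e₂], [ρ₀(h)e₃])` of the flat bundle. -/
def stdSection (ι : Γ →* H) (u : Γ →* Multiplicative ℝ) : M ι → E ι (linearDeformation ι u) :=
  Quotient.map (fun h => (h, stdFrame h)) (by
    rintro h _ ⟨γ, rfl⟩
    exact ⟨γ, by rw [linearDeformation_smul_stdFrame]⟩)

theorem continuous_stdSection : Continuous (stdSection ι u) :=
  (continuous_id.prodMk continuous_stdFrame).quotient_map' _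

theorem eq_stdFrame_of_mem_range {h : H} {y : Frame}
    (hy : Quotient.mk (bundleSetoid ι (linearDeformation ι u)) (h, y) ∈
      Set.range (stdSection ι u)) : y = stdFrame h := by
  obtain ⟨p, hp⟩ := hy
  induction p using Quotient.inductionOn with | _ h' =>
  obtain ⟨γ, hγ⟩ := Quotient.exact hp
  have h1 := congrArg Prod.fst hγ
  have h2 := congrArg Prod.snd hγ
  simp only at h1 h2
  rw [h2, linearDeformation_smul_stdFrame, h1]

/-- The element `γ₁⁻¹γ₂` equals `k₁ a^t k₂⁻¹`, whose entries are `O(e^{|t|})`. Its translation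
length is therefore at most `2|t| + O(1)`, and the bound on `u` applies to it. -/
theorem exists_abs_sub_le {κ : ℝ} (hκ : 0 ≤ κ)
    (hu : ∀ γ, |(u γ).toAdd| ≤ κ * transLength ι γ) {K : Set H} (hK : IsCompact K) :
    ∃ C : ℝ, ∀ (γ₁ γ₂ : Γ), ∀ k₁ ∈ K, ∀ k₂ ∈ K, ∀ t : ℝ,
      ι γ₁ * k₁ * aFlow t = ι γ₂ * k₂ →
        |(u γ₂).toAdd - (u γ₁).toAdd| ≤ 2 * κ * |t| + C := by
  obtain ⟨B, hB1, hB⟩ := exists_entry_bound hK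
  refine ⟨κ * (2 * Real.log (8 * B * B + 1)), fun γ₁ γ₂ k₁ hk₁ k₂ hk₂ t e => ?_⟩
  have he : ι (γ₁⁻¹ * γ₂) = k₁ * (aFlow t * k₂⁻¹) := by
    rw [map_mul, map_inv, inv_mul_eq_iff_eq_mul, ← mul_assoc, ← mul_assoc, e]
    simp
  have ha : ∀ i j, |aFlow t i j| ≤ Real.exp |t| := by
    have h0 := (Real.exp_pos |t|).le
    have h1 := le_abs_self t
    have h2 := neg_le_abs t
    intro i j
    fin_cases i <;> fin_cases j <;> simp [aFlow] <;> assumption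
  have h1 := specRadius_le_of_entry_le (ι := ι) (γ₁⁻¹ * γ₂)
    (C := 2 * (B * (2 * (Real.exp |t| * B)))) (fun i j => by
      rw [he, Matrix.SpecialLinearGroup.coe_mul, Matrix.SpecialLinearGroup.coe_mul]
      exact entry_mul_le (fun i j => (hB k₁ hk₁ i j).1)
        (entry_mul_le ha fun i j => (hB k₂ hk₂ i j).2) i j)
  have h2 : (1 : ℝ) ≤ Real.exp |t| := Real.one_le_exp (abs_nonneg t)
  have h3 := Real.log_le_log (lt_of_lt_of_le one_pos (one_le_specRadius _))
    (h1.trans (show _ ≤ (8 * B * B + 1) * Real.exp |t| by nlinarith))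
  rw [Real.log_mul (by positivity) (Real.exp_pos _).ne', Real.log_exp] at h3
  have h4 := hu (γ₁⁻¹ * γ₂)
  have h5 : (u (γ₁⁻¹ * γ₂)).toAdd = (u γ₂).toAdd - (u γ₁).toAdd := by
    rw [map_mul, map_inv, toAdd_mul, toAdd_inv]; ring
  rw [h5] at h4
  refine h4.trans ?_
  rw [transLength]
  nlinarith [mul_le_mul_of_nonneg_left h3 hκ]

/-- Contraction of an entry under the diagonal flow. -/
theorem weight_le {κ C s t : ℝ} (ht : 0 ≤ t) (hκ : 0 ≤ κ) (_hC : 0 ≤ C)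
    (hs : |s| ≤ 2 * κ * t + C) {i j : Fin 3} (hij : i < j) :
    s * (phiWeight i - phiWeight j) + t * (aWeight i - aWeight j) ≤ -(1 - 2 * κ) * t + C := by
  have h1 := le_abs_self s
  have h2 := neg_abs_le s
  have h3 := mul_nonneg hκ ht
  fin_cases i <;> fin_cases j <;> simp [phiWeight, aWeight] at hij ⊢ <;> nlinarith

/-- Contraction of an entry under the inverse of the diagonal flow. -/
theorem weight_neg_le {κ C s t : ℝ} (ht : 0 ≤ t) (hκ : 0 ≤ κ) (hC : 0 ≤ C)
    (hs : |s| ≤ 2 * κ * t + C) {i j : Fin 3} (hij : j < i) :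
    s * (phiWeight i - phiWeight j) + -t * (aWeight i - aWeight j) ≤
      -(1 - 2 * κ) * t + C := by
  have := weight_le ht hκ hC (s := -s) (by rwa [abs_neg]) hij
  linarith

/-- Subtracting the diagonal part in frame coordinates changes nothing in the quotient and gives the
representative to which the norm comparison applies. -/
theorem exists_offDiag_of_mem_map {F : Matrix (Fin 3) (Fin 3) ℝ} (g : G) (hF : F = g.1)
    (hdet : F.det ≠ 0) (ξ : Matrix (Fin 3) (Fin 3) ℝ) :
    ∃ η : Matrix (Fin 3) (Fin 3) ℝ, (∀ i, η i i = 0) ∧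
      (∀ i j, i ≠ j → η i j = (F⁻¹ * ξ * F) i j) ∧
      (isotropy (frameOf F hdet)).mkQ ξ =
        (isotropy (frameOf F hdet)).mkQ (g.1 * η * g⁻¹.1) := by
  subst hF
  refine ⟨g.1⁻¹ * ξ * g.1 - Matrix.diagonal fun i => (g.1⁻¹ * ξ * g.1) i i,
    fun i => by simp, fun i j hij => by simp [Matrix.diagonal_apply_ne _ hij], ?_⟩
  rw [Submodule.mkQ_apply, Submodule.mkQ_apply, Submodule.Quotient.eq, mem_isotropy_frameOf]
  intro i j hij
  rw [Matrix.mul_sub, Matrix.sub_mul, coe_inv_eq, inv_conj_conj]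
  simp [Matrix.diagonal_apply_ne _ hij]

theorem isAnosov_of_abs_le (hι : IsClosedSurfaceEmbedding ι) {κ : ℝ} (hκ : 0 ≤ κ)
    (hκ2 : κ < 1 / 2) (hu : ∀ γ, |(u γ).toAdd| ≤ κ * transLength ι γ) :
    IsAnosov ι (linearDeformation ι u) := by
  refine ⟨stdSection ι u, continuous_stdSection, ?_, ?_, ?_⟩
  · intro p
    induction p using Quotient.inductionOn with | _ h => rfl
  · rintro t _ ⟨p, rfl⟩
    induction p using Quotient.inductionOn with | _ h =>
    refine ⟨Quotient.mk _ (h * aFlow t), ?_⟩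
    change Quotient.mk _ (h * aFlow t, stdFrame (h * aFlow t)) =
      Quotient.mk _ (h * aFlow t, stdFrame h)
    rw [stdFrame_mul_aFlow]
  intro N
  obtain ⟨K, hK, hcov⟩ := exists_isCompact_cover hι
  obtain ⟨C₀, hC₀⟩ := exists_abs_sub_le hκ hu hK
  obtain ⟨c, hc, B, hB, hcB⟩ := N.exists_std_bounds hK
  set C := max C₀ 0
  have hCnn : 0 ≤ C := le_max_right _ _
  refine ⟨1 - 2 * κ, by linarith, B * Real.exp C * c⁻¹, by positivity, fun h y hy t ht => ?_⟩
  obtain rfl := eq_stdFrame_of_mem_range hy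
  -- Both bundles are handled at once, with `r = t` for `E⁺` and `r = -t` for `E⁻`. The weight
  -- estimate is required only at nonzero entries, which are above or below the diagonal
  -- respectively.
  have key : ∀ (r : ℝ) (ξ : Matrix (Fin 3) (Fin 3) ℝ), (∀ i, ξ i i = 0) → |r| = t →
      (∀ s : ℝ, |s| ≤ 2 * κ * t + C → ∀ i j, ξ i j ≠ 0 →
        s * (phiWeight i - phiWeight j) + r * (aWeight i - aWeight j) ≤
          -(1 - 2 * κ) * t + C) →
      N.val (h * aFlow r) (stdFrame h) ((rho0 h).1 * ξ * (rho0 h)⁻¹.1) ≤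
        B * Real.exp C * c⁻¹ * Real.exp (-(1 - 2 * κ) * t) *
          N.val h (stdFrame h) ((rho0 h).1 * ξ * (rho0 h)⁻¹.1) := by
    intro r ξ hξ hr hw
    have e1 : N.val (h * aFlow r) (stdFrame h) ((rho0 h).1 * ξ * (rho0 h)⁻¹.1) =
        N.std (h * aFlow r) ((rho0 (aFlow r))⁻¹.1 * ξ * (rho0 (aFlow r)).1) := by
      rw [VerticalNorm.std, stdFrame_mul_aFlow, map_mul rho0, mul_conj, conj_inv_conj]
    rw [e1]
    change _ ≤ _ * N.std h ξ
    obtain ⟨γ₁, k₁, hk₁, e₁⟩ := hcov h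
    obtain ⟨γ₂, k₂, hk₂, e₂⟩ := hcov (h * aFlow r)
    have hs := hC₀ γ₁ γ₂ k₁ hk₁ k₂ hk₂ r (by rw [← e₁, e₂])
    rw [hr] at hs
    replace hs : _ ≤ 2 * κ * t + C := hs.trans (by linarith [le_max_left C₀ 0])
    rw [e₂, e₁, N.std_mul, N.std_mul]
    have h1 := (hcB k₂ hk₂ ((phi (u γ₂).toAdd)⁻¹.1 *
      ((rho0 (aFlow r))⁻¹.1 * ξ * (rho0 (aFlow r)).1) * (phi (u γ₂).toAdd).1) (fun i => by
        rw [phi_inv_conj_apply, aFlow_inv_conj_apply, hξ]; simp)).2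
    have h2 := (hcB k₁ hk₁ ((phi (u γ₁).toAdd)⁻¹.1 * ξ * (phi (u γ₁).toAdd).1) (fun i => by
        rw [phi_inv_conj_apply, hξ]; simp)).1
    have h3 := entrySum_le_of_entry_le (c := Real.exp (-(1 - 2 * κ) * t + C))
      (ξ := (phi (u γ₂).toAdd)⁻¹.1 *
        ((rho0 (aFlow r))⁻¹.1 * ξ * (rho0 (aFlow r)).1) * (phi (u γ₂).toAdd).1)
      (η := (phi (u γ₁).toAdd)⁻¹.1 * ξ * (phi (u γ₁).toAdd).1) (fun i j => by
        rw [phi_inv_conj_apply, aFlow_inv_conj_apply, phi_inv_conj_apply]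
        by_cases h0 : ξ i j = 0
        · simp [h0]
        rw [abs_mul, abs_mul, abs_mul, Real.abs_exp, Real.abs_exp, Real.abs_exp, ← mul_assoc,
          ← mul_assoc, ← Real.exp_add, ← Real.exp_add]
        refine mul_le_mul_of_nonneg_right (Real.exp_le_exp.mpr ?_) (abs_nonneg _)
        linarith [hw _ hs i j h0])
    refine h1.trans ((mul_le_mul_of_nonneg_left h3 hB.le).trans ?_)
    rw [Real.exp_add]
    have h4 := (le_inv_mul_iff₀ hc).mpr h2
    calc _ = B * Real.exp C * Real.exp (-(1 - 2 * κ) * t) *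
          entrySum ((phi (u γ₁).toAdd)⁻¹.1 * ξ * (phi (u γ₁).toAdd).1) := by ring
      _ ≤ B * Real.exp C * Real.exp (-(1 - 2 * κ) * t) * _ :=
        mul_le_mul_of_nonneg_left h4 (by positivity)
      _ = _ := by ring
  constructor
  · rintro _ ⟨ξ, hξ, rfl⟩
    obtain ⟨η, hη, hη', e⟩ := exists_offDiag_of_mem_map (rho0 h) rfl (rho0_det_ne_zero h) ξ
    have hξ' := (mem_flagIsotropy_piPlus (rho0_det_ne_zero h) ξ).mp hξ
    refine (congrArg₂ (· ≤ ·) (congrArg _ e) (congrArg _ (congrArg _ e))).mpr ?_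
    refine key t η hη (abs_of_pos ht) fun s hs i j h0 => ?_
    have hij : i ≠ j := by rintro rfl; exact h0 (hη i)
    have hlt : i < j := by
      by_contra hcon
      exact h0 ((hη' i j hij).trans (hξ' i j (lt_of_le_of_ne (not_lt.mp hcon) hij.symm)))
    exact weight_le ht.le hκ hCnn hs hlt
  · rintro _ ⟨ξ, hξ, rfl⟩
    obtain ⟨η, hη, hη', e⟩ := exists_offDiag_of_mem_map (rho0 h) rfl (rho0_det_ne_zero h) ξ
    have hξ' := (mem_flagIsotropy_piMinus (rho0_det_ne_zero h) ξ).mp hξ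
    refine (congrArg₂ (· ≤ ·) (congrArg _ e) (congrArg _ (congrArg _ e))).mpr ?_
    refine key (-t) η hη (by rw [abs_neg, abs_of_pos ht]) fun s hs i j h0 => ?_
    have hij : i ≠ j := by rintro rfl; exact h0 (hη i)
    have hlt : j < i := by
      by_contra hcon
      exact h0 ((hη' i j hij).trans (hξ' i j (lt_of_le_of_ne (not_lt.mp hcon) hij)))
    exact weight_neg_le ht.le hκ hCnn hs hlt

end SmallNorm

/-! ### A continuous norm on the vertical tangent bundle -/

/-- The orthogonal projector onto a line. -/
def projector (l : ℙ ℝ V) : Matrix (Fin 3) (Fin 3) ℝ :=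
  (l.rep ⬝ᵥ l.rep)⁻¹ • Matrix.vecMulVec l.rep l.rep

theorem dotProduct_self_pos {v : V} (hv : v ≠ 0) : 0 < v ⬝ᵥ v :=
  lt_of_le_of_ne (Finset.sum_nonneg fun _ _ => mul_self_nonneg _)
    fun h => hv (dotProduct_self_eq_zero.mp h.symm)

theorem projector_mk (v : V) (hv : v ≠ 0) :
    projector (Projectivization.mk ℝ v hv) = (v ⬝ᵥ v)⁻¹ • Matrix.vecMulVec v v := by
  obtain ⟨a, ha⟩ := Projectivization.exists_smul_eq_mk_rep ℝ v hv
  have ha0 : (a : ℝ) ≠ 0 := a.ne_zero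
  have hv0 := (dotProduct_self_pos hv).ne'
  rw [projector, ← ha]
  ext i j
  simp only [Units.smul_def, smul_dotProduct, dotProduct_smul, Matrix.smul_apply,
    Matrix.vecMulVec_apply, Pi.smul_apply, smul_eq_mul]
  field_simp

theorem continuous_projector : Continuous projector := by
  refine continuous_coinduced_dom.mpr ?_
  have h : (projector ∘ Projectivization.mk' ℝ : {v : V // v ≠ 0} → _) =
      fun v => (v.1 ⬝ᵥ v.1)⁻¹ • Matrix.vecMulVec v.1 v.1 :=
    funext fun v => projector_mk v.1 v.2
  rw [h]
  have h0 : Continuous fun v : V => v ⬝ᵥ v := by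
    simp only [dotProduct]; fun_prop
  have h1 : Continuous fun v : {v : V // v ≠ 0} => v.1 ⬝ᵥ v.1 := h0.comp continuous_subtype_val
  have h2 : Continuous fun v : V => Matrix.vecMulVec v v :=
    continuous_matrix fun i j => by simp only [Matrix.vecMulVec_apply]; fun_prop
  exact (h1.inv₀ fun v => (dotProduct_self_pos v.2).ne').smul (h2.comp continuous_subtype_val)

theorem conj_projector_eq (g : G) (v : V) (hv : v ≠ 0) :
    g.1 * projector (Projectivization.mk ℝ v hv) * g.1ᵀ =
      (v ⬝ᵥ v)⁻¹ • Matrix.vecMulVec (g • v) (g • v) := by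
  rw [projector_mk, Matrix.mul_smul, Matrix.smul_mul, Matrix.mul_vecMulVec, Matrix.vecMulVec_mul,
    Matrix.vecMul_transpose]
  rfl

theorem trace_conj_projector_ne_zero (g : G) (l : ℙ ℝ V) :
    (g.1 * projector l * g.1ᵀ).trace ≠ 0 := by
  induction l using Projectivization.ind with | _ v hv =>
  rw [conj_projector_eq, Matrix.trace_smul, Matrix.trace_vecMulVec]
  exact mul_ne_zero (inv_ne_zero (dotProduct_self_pos hv).ne')
    (dotProduct_self_pos ((smul_ne_zero_iff_ne g).mpr hv)).ne'

/-- The matrix `g P gᵀ` is symmetric of rank one with image the line `g • l`; normalizing its trace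
gives the projector. This formula shows joint continuity in `g` and the line without local lifts. -/
theorem projector_smul (g : G) (l : ℙ ℝ V) :
    projector (g • l) = (g.1 * projector l * g.1ᵀ).trace⁻¹ • (g.1 * projector l * g.1ᵀ) := by
  induction l using Projectivization.ind with | _ v hv =>
  have h1 := dotProduct_self_pos hv
  rw [conj_projector_eq, Matrix.trace_smul, Matrix.trace_vecMulVec, Projectivization.smul_mk,
    projector_mk, smul_smul, smul_eq_mul, mul_inv, inv_inv, mul_right_comm,
    mul_inv_cancel₀ h1.ne', one_mul]

theorem continuous_projector_smul {X : Type*} [TopologicalSpace X] {g : X → G} {y : X → Frame}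
    (hg : Continuous g) (hy : Continuous y) (i : Fin 3) :
    Continuous fun x => projector ((g x • y x).1 i) := by
  have hg1 : Continuous fun x => (g x).1 := continuous_subtype_val.comp hg
  have hP : Continuous fun x => projector ((y x).1 i) :=
    continuous_projector.comp ((continuous_apply i).comp (continuous_subtype_val.comp hy))
  have h0 : Continuous fun x => (g x).1 * projector ((y x).1 i) * (g x).1ᵀ :=
    (hg1.mul hP).mul hg1.matrix_transpose
  exact ((h0.matrix_trace.inv₀ fun x =>
    trace_conj_projector_ne_zero (g x) ((y x).1 i)).smul h0).congr fun x =>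
      (projector_smul (g x) ((y x).1 i)).symm

theorem projector_mulVec_mem (l : ℙ ℝ V) (w : V) : (projector l).mulVec w ∈ l.submodule := by
  rw [Projectivization.submodule_eq, projector, Matrix.smul_mulVec, Matrix.vecMulVec_mulVec,
    op_smul_eq_smul]
  exact Submodule.smul_mem _ _ (Submodule.smul_mem _ _ (Submodule.mem_span_singleton_self _))

theorem projector_mulVec_of_mem (l : ℙ ℝ V) {w : V} (hw : w ∈ l.submodule) :
    (projector l).mulVec w = w := by
  rw [Projectivization.submodule_eq] at hw
  obtain ⟨a, rfl⟩ := Submodule.mem_span_singleton.mp hw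
  have h1 := dotProduct_self_pos l.rep_nonzero
  rw [projector, Matrix.smul_mulVec, Matrix.vecMulVec_mulVec, op_smul_eq_smul, dotProduct_smul,
    smul_smul, smul_eq_mul, mul_comm a, ← mul_assoc, inv_mul_cancel₀ h1.ne', one_mul]

/-- The matrix `(1 - P) ξ P` is the component of `ξ` carrying the line to its orthogonal complement.
The sizes of these components for the three lines of a frame make up `frameNorm`. -/
theorem mem_preserving_iff_projector (l : ℙ ℝ V) (ξ : Matrix (Fin 3) (Fin 3) ℝ) :
    ξ ∈ preserving l.submodule ↔ (1 - projector l) * ξ * projector l = 0 := by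
  have key : ∀ w, ((1 - projector l) * ξ * projector l).mulVec w =
      ξ.mulVec ((projector l).mulVec w) -
        (projector l).mulVec (ξ.mulVec ((projector l).mulVec w)) := fun w => by
    rw [← Matrix.mulVec_mulVec, ← Matrix.mulVec_mulVec, Matrix.sub_mulVec, Matrix.one_mulVec]
  constructor
  · intro h
    refine Matrix.mulVec_injective (funext fun w => ?_)
    rw [key, projector_mulVec_of_mem l (h _ (projector_mulVec_mem l w)), sub_self,
      Matrix.zero_mulVec]
  · intro h w hw
    have h1 := key w
    rw [h, Matrix.zero_mulVec, projector_mulVec_of_mem l hw] at h1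
    rw [sub_eq_zero.mp h1.symm]
    exact projector_mulVec_mem l _

theorem mem_submodule_smul_iff (g : G) (l : ℙ ℝ V) (w : V) :
    w ∈ (g • l).submodule ↔ g⁻¹ • w ∈ l.submodule := by
  induction l using Projectivization.ind with | _ v hv =>
  rw [Projectivization.smul_mk, Projectivization.submodule_mk, Projectivization.submodule_mk,
    Submodule.mem_span_singleton, Submodule.mem_span_singleton]
  refine exists_congr fun a => ?_
  rw [eq_inv_smul_iff, smul_comm g a]

theorem mem_preserving_smul_iff (g : G) (l : ℙ ℝ V) (ξ : Matrix (Fin 3) (Fin 3) ℝ) :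
    g⁻¹.1 * ξ * g.1 ∈ preserving (g⁻¹ • l).submodule ↔ ξ ∈ preserving l.submodule := by
  have key : ∀ w : V, (g⁻¹.1 * ξ * g.1).mulVec w = g⁻¹ • ξ.mulVec (g • w) := fun w => by
    rw [← Matrix.mulVec_mulVec, ← Matrix.mulVec_mulVec]; rfl
  constructor
  · intro h w hw
    have h1 := h (g⁻¹ • w) (by rwa [mem_submodule_smul_iff, inv_inv, smul_inv_smul])
    rwa [key, mem_submodule_smul_iff, inv_inv, smul_inv_smul, smul_inv_smul] at h1
  · intro h w hw
    rw [mem_submodule_smul_iff, inv_inv] at hw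
    rw [key, mem_submodule_smul_iff, inv_inv, smul_inv_smul]
    exact h _ hw

theorem mem_isotropy_smul_iff (g : G) (y : Frame) (ξ : Matrix (Fin 3) (Fin 3) ℝ) :
    g⁻¹.1 * ξ * g.1 ∈ isotropy (g⁻¹ • y) ↔ ξ ∈ isotropy y := by
  simp only [isotropy, Submodule.mem_iInf]
  exact forall_congr' fun i => mem_preserving_smul_iff g (y.1 i) ξ

theorem entrySum_add_le (ξ η : Matrix (Fin 3) (Fin 3) ℝ) :
    entrySum (ξ + η) ≤ entrySum ξ + entrySum η := by
  simp only [entrySum, ← Finset.sum_add_distrib]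
  exact Finset.sum_le_sum fun i _ => Finset.sum_le_sum fun j _ => abs_add_le _ _

/-- The norm of the vector of `T_y Y` represented by `ξ`. -/
def frameNorm (y : Frame) (ξ : Matrix (Fin 3) (Fin 3) ℝ) : ℝ :=
  ∑ i, entrySum ((1 - projector (y.1 i)) * ξ * projector (y.1 i))

/-- The linear map whose norm is `frameNorm`, after transport by `g`. -/
def frameMap (g : G) (y : Frame) :
    Matrix (Fin 3) (Fin 3) ℝ →ₗ[ℝ] Fin 3 → Matrix (Fin 3) (Fin 3) ℝ where
  toFun ξ i := (1 - projector ((g⁻¹ • y).1 i)) * (g⁻¹.1 * ξ * g.1) * projector ((g⁻¹ • y).1 i)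
  map_add' ξ η := by
    funext i
    simp only [Matrix.mul_add, Matrix.add_mul, Pi.add_apply]
  map_smul' c ξ := by
    funext i
    simp only [Matrix.mul_smul, Matrix.smul_mul, Pi.smul_apply, RingHom.id_apply]

theorem frameMap_eq_zero_iff (g : G) (y : Frame) (ξ : Matrix (Fin 3) (Fin 3) ℝ) :
    frameMap g y ξ = 0 ↔ ξ ∈ isotropy y := by
  rw [← mem_isotropy_smul_iff g, isotropy, Submodule.mem_iInf, funext_iff]
  exact forall_congr' fun i => (mem_preserving_iff_projector _ _).symm

/-- The sum of the absolute values of all entries of a triple of matrices. -/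
def entrySumSeminorm : Seminorm ℝ (Fin 3 → Matrix (Fin 3) (Fin 3) ℝ) :=
  Seminorm.of (fun X => ∑ i, entrySum (X i))
    (fun X Y => by
      rw [← Finset.sum_add_distrib]
      exact Finset.sum_le_sum fun i _ => entrySum_add_le _ _)
    (fun c X => by
      rw [Finset.mul_sum]
      exact Finset.sum_congr rfl fun i _ => entrySum_smul c (X i))

theorem eq_zero_of_entrySumSeminorm {X : Fin 3 → Matrix (Fin 3) (Fin 3) ℝ}
    (h : entrySumSeminorm X = 0) : X = 0 := by
  have h0 : ∑ i, entrySum (X i) = 0 := h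
  have h1 := (Finset.sum_eq_zero_iff_of_nonneg fun i _ => entrySum_nonneg (X i)).mp h0
  exact funext fun i => eq_zero_of_entrySum (h1 i (Finset.mem_univ i))

/-- The transported norm on the tangent space `T_y Y`. -/
def frameSeminorm (g : G) (y : Frame) : Seminorm ℝ (FrameTangent y) :=
  entrySumSeminorm.comp ((isotropy y).liftQ (frameMap g y)
    fun ξ hξ => LinearMap.mem_ker.mpr ((frameMap_eq_zero_iff g y ξ).mpr hξ))

theorem frameSeminorm_mkQ (g : G) (y : Frame) (ξ : Matrix (Fin 3) (Fin 3) ℝ) :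
    frameSeminorm g y ((isotropy y).mkQ ξ) = frameNorm (g⁻¹ • y) (g⁻¹.1 * ξ * g.1) := rfl

theorem frameSeminorm_definite (g : G) (y : Frame) (v : FrameTangent y)
    (hv : frameSeminorm g y v = 0) : v = 0 := by
  obtain ⟨ξ, rfl⟩ := Submodule.mkQ_surjective _ v
  have h1 : frameMap g y ξ = 0 := eq_zero_of_entrySumSeminorm hv
  rw [Submodule.mkQ_apply, Submodule.Quotient.mk_eq_zero]
  exact (frameMap_eq_zero_iff g y ξ).mp h1

section Norm

variable {Γ : Type*} [Group Γ] {ι : Γ →* H} {ρ : Γ →* G}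

/-- The vertical norm given by a continuous map `g : H → G` that is equivariant. -/
def equivariantNorm (ι : Γ →* H) (ρ : Γ →* G) (g : H → G) (hg : Continuous g)
    (heq : ∀ γ h, g (ι γ * h) = ρ γ * g h) : VerticalNorm ι ρ where
  toSeminorm h y := frameSeminorm (g h) y
  definite h y v hv := frameSeminorm_definite (g h) y v hv
  continuous := by
    simp only [frameSeminorm_mkQ, frameNorm]
    have hgi : Continuous fun p : H × Frame × Matrix (Fin 3) (Fin 3) ℝ => (g p.1)⁻¹.1 :=
      continuous_subtype_val.comp (hg.inv.comp continuous_fst)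
    have hg1 : Continuous fun p : H × Frame × Matrix (Fin 3) (Fin 3) ℝ => (g p.1).1 :=
      continuous_subtype_val.comp (hg.comp continuous_fst)
    refine continuous_finsetSum _ fun i _ => continuous_entrySum.comp ?_
    have hQ := continuous_projector_smul (hg.comp continuous_fst).inv
      (continuous_fst.comp continuous_snd : Continuous fun p : H × Frame ×
        Matrix (Fin 3) (Fin 3) ℝ => p.2.1) i
    exact ((continuous_const.sub hQ).mul ((hgi.mul (continuous_snd.comp continuous_snd)).mul
      hg1)).mul hQ
  invariant γ h y ξ := by
    rw [frameSeminorm_mkQ, frameSeminorm_mkQ, heq, mul_inv_rev, mul_smul, inv_smul_smul]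
    congr 1
    change (g h)⁻¹.1 * (ρ γ)⁻¹.1 * ((ρ γ).1 * ξ * (ρ γ)⁻¹.1) * ((ρ γ).1 * (g h).1) = _
    have h1 := inv_conj_conj (ρ γ) ξ
    calc _ = (g h)⁻¹.1 * ((ρ γ)⁻¹.1 * ((ρ γ).1 * ξ * (ρ γ)⁻¹.1) * (ρ γ).1) * (g h).1 := by
          simp only [Matrix.mul_assoc]
      _ = _ := by rw [h1]

theorem equivariantNorm_val (g : H → G) (hg : Continuous g)
    (heq : ∀ γ h, g (ι γ * h) = ρ γ * g h) (h : H) (y : Frame)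
    (ξ : Matrix (Fin 3) (Fin 3) ℝ) :
    (equivariantNorm ι ρ g hg heq).val h y ξ =
      frameNorm ((g h)⁻¹ • y) ((g h)⁻¹.1 * ξ * (g h).1) := rfl

/-! ### Sections of the flat bundle as equivariant maps -/

theorem continuous_smul_frame (g : G) : Continuous fun y : Frame => g • y := by
  refine Continuous.subtype_mk (continuous_pi fun i => ?_) _
  have h1 : Continuous fun l : ℙ ℝ V => g • l := by
    refine continuous_coinduced_dom.mpr ?_
    have h2 : Continuous (Projectivization.mk' ℝ : {v : V // v ≠ 0} → ℙ ℝ V) :=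
      continuous_coinduced_rng
    have h3 : Continuous fun v : {v : V // v ≠ 0} => g.1 *ᵥ v.1 :=
      continuous_const.matrix_mulVec continuous_subtype_val
    exact h2.comp (h3.subtype_mk fun v => (smul_ne_zero_iff_ne g).mpr v.2)
  exact h1.comp ((continuous_apply i).comp continuous_subtype_val)

theorem isOpenMap_mk_bundle (ι : Γ →* H) (ρ : Γ →* G) :
    IsOpenMap (Quotient.mk (bundleSetoid ι ρ)) := by
  intro U hU
  refine (isQuotientMap_quotient_mk' (s := bundleSetoid ι ρ)).isOpen_preimage.mp ?_
  have : Quotient.mk (bundleSetoid ι ρ) ⁻¹' (Quotient.mk (bundleSetoid ι ρ) '' U) =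
      ⋃ γ : Γ, (fun p : H × Frame => (ι γ * p.1, ρ γ • p.2)) ⁻¹' U := by
    ext p
    simp only [Set.mem_preimage, Set.mem_image, Set.mem_iUnion]
    constructor
    · rintro ⟨q, hq, e⟩
      obtain ⟨γ, rfl⟩ := Quotient.exact e
      refine ⟨γ⁻¹, ?_⟩
      simpa using hq
    · rintro ⟨γ, hγ⟩
      exact ⟨_, hγ, Quotient.sound ⟨γ⁻¹, by simp⟩⟩
  refine this ▸ ?_
  exact isOpen_iUnion fun γ => hU.preimage ((continuous_const.mul continuous_fst).prodMk
    ((continuous_smul_frame (ρ γ)).comp continuous_snd))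

theorem eq_of_mk_eq_mk (hι : IsClosedSurfaceEmbedding ι) {h : H} {y y' : Frame}
    (e : Quotient.mk (bundleSetoid ι ρ) (h, y) = Quotient.mk (bundleSetoid ι ρ) (h, y')) :
    y = y' := by
  obtain ⟨γ, hγ⟩ := Quotient.exact e
  have h1 : h = ι γ * h := congrArg Prod.fst hγ
  have h2 : y' = ρ γ • y := congrArg Prod.snd hγ
  have h3 : ι γ = 1 := mul_eq_right.mp h1.symm
  have h4 : γ = 1 := hι.injective (h3.trans (map_one ι).symm)
  rw [h2, h4, map_one, one_smul]

/-- Injectivity of `ι` makes the action on `H` free, so each fibre of the bundle over `M` is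
identified with `Y` once a point `h` is chosen. Uniqueness of the lift gives its equivariance and
its invariance under the flow. -/
theorem exists_lift_section (hι : IsClosedSurfaceEmbedding ι) {s : M ι → E ι ρ}
    (hc : Continuous s) (hs : ∀ p, bundleProj ι ρ (s p) = p)
    (hinv : ∀ t : ℝ, Set.MapsTo (flowE ι ρ t) (Set.range s) (Set.range s)) :
    ∃ σ : H → Frame, Continuous σ ∧ (∀ γ h, σ (ι γ * h) = ρ γ • σ h) ∧
      (∀ h t, σ (h * aFlow t) = σ h) ∧
      ∀ h, Quotient.mk (bundleSetoid ι ρ) (h, σ h) = s (Quotient.mk (orbitSetoid ι) h) := by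
  have hex : ∀ h : H, ∃ y : Frame,
      Quotient.mk (bundleSetoid ι ρ) (h, y) = s (Quotient.mk (orbitSetoid ι) h) := by
    intro h
    obtain ⟨⟨h', y⟩, e⟩ := Quotient.exists_rep (s (Quotient.mk (orbitSetoid ι) h))
    have h1 := hs (Quotient.mk (orbitSetoid ι) h)
    rw [← e] at h1
    obtain ⟨γ, hγ⟩ := Quotient.exact h1
    refine ⟨ρ γ • y, ?_⟩
    rw [← e]
    exact (Quotient.sound ⟨γ, by rw [hγ]⟩ :
      Quotient.mk (bundleSetoid ι ρ) (h', y) = Quotient.mk _ (h, ρ γ • y)).symm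
  choose σ hσ using hex
  refine ⟨σ, ?_, fun γ h => ?_, fun h t => ?_, hσ⟩
  · rw [continuous_iff_continuousAt]
    intro h₀
    obtain ⟨W, hW, hW0, hWγ⟩ := exists_nhds_eq_one_of_mul_mem hι h₀
    intro U hU
    obtain ⟨U', hU'U, hU', hU'0⟩ := mem_nhds_iff.mp hU
    -- Continuity of `s` puts the class of `(h, σ h)` in this open image; since no `γ ≠ 1` returns a
    -- point of `W` to `W`, the lift itself lies in `U'`.
    have ho : IsOpen (Quotient.mk (bundleSetoid ι ρ) '' (W ×ˢ U')) :=
      isOpenMap_mk_bundle ι ρ _ (hW.prod hU')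
    have hcont : Continuous fun h : H => s (Quotient.mk (orbitSetoid ι) h) :=
      hc.comp continuous_quotient_mk'
    have hn : (fun h : H => s (Quotient.mk (orbitSetoid ι) h)) ⁻¹'
        (Quotient.mk (bundleSetoid ι ρ) '' (W ×ˢ U')) ∈ 𝓝 h₀ :=
      (ho.preimage hcont).mem_nhds ⟨(h₀, σ h₀), ⟨hW0, hU'0⟩, hσ h₀⟩
    rw [Filter.mem_map]
    filter_upwards [hn, hW.mem_nhds hW0] with h hh hhW
    obtain ⟨⟨w, y⟩, ⟨hw, hy⟩, e⟩ := hh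
    refine hU'U ?_
    have e' : Quotient.mk (bundleSetoid ι ρ) (w, y) = Quotient.mk _ (h, σ h) :=
      e.trans (hσ h).symm
    obtain ⟨γ, hγ⟩ := Quotient.exact e'
    have h1 : h = ι γ * w := congrArg Prod.fst hγ
    have h2 : σ h = ρ γ • y := congrArg Prod.snd hγ
    have h3 : γ = 1 := hWγ γ w hw (h1 ▸ hhW)
    rw [h2, h3, map_one, one_smul]
    exact hy
  · refine eq_of_mk_eq_mk (ρ := ρ) hι (h := ι γ * h) ?_
    have h1 : Quotient.mk (orbitSetoid ι) (ι γ * h) = Quotient.mk (orbitSetoid ι) h :=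
      (Quotient.sound ⟨γ, rfl⟩ : Quotient.mk (orbitSetoid ι) h = _).symm
    rw [hσ, h1, ← hσ]
    exact Quotient.sound ⟨γ, rfl⟩
  · refine eq_of_mk_eq_mk (ρ := ρ) hι (h := h * aFlow t) ?_
    -- Invariance of the image as a set suffices, since the projection to `M` determines which point
    -- of the section is reached.
    obtain ⟨p, hp⟩ := hinv t ⟨Quotient.mk (orbitSetoid ι) h, rfl⟩
    rw [← hσ] at hp
    have h1 := hs p
    rw [hp] at h1
    rw [hσ]
    exact (congrArg s h1).trans hp

end Norm

/-! ### Estimates in frames with unit columns -/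

theorem entrySum_le_of_le {X : Matrix (Fin 3) (Fin 3) ℝ} {c : ℝ} (h : ∀ i j, |X i j| ≤ c) :
    entrySum X ≤ 9 * c := by
  calc entrySum X ≤ ∑ _i : Fin 3, ∑ _j : Fin 3, c :=
        Finset.sum_le_sum fun i _ => Finset.sum_le_sum fun j _ => h i j
    _ = 9 * c := by simp; ring

theorem entrySum_mul_le (X Y : Matrix (Fin 3) (Fin 3) ℝ) :
    entrySum (X * Y) ≤ entrySum X * entrySum Y := by
  have h1 : ∀ i j, |(X * Y) i j| ≤ ∑ k, |X i k| * |Y k j| := fun i j => by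
    rw [Matrix.mul_apply]
    refine (Finset.abs_sum_le_sum_abs _ _).trans (le_of_eq ?_)
    simp only [abs_mul]
  have h2 : ∀ i, ∑ j, |(X * Y) i j| ≤ (∑ k, |X i k|) * entrySum Y := fun i => by
    refine (Finset.sum_le_sum fun j _ => h1 i j).trans ?_
    rw [Finset.sum_comm, Finset.sum_mul]
    refine Finset.sum_le_sum fun k _ => ?_
    rw [← Finset.mul_sum]
    exact mul_le_mul_of_nonneg_left (Finset.single_le_sum (f := fun k => ∑ j, |Y k j|)
      (fun _ _ => Finset.sum_nonneg fun _ _ => abs_nonneg _) (Finset.mem_univ k)) (abs_nonneg _)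
  refine (Finset.sum_le_sum fun i _ => h2 i).trans (le_of_eq ?_)
  rw [← Finset.sum_mul]
  rfl

theorem abs_mul_mul_apply_le {A X C : Matrix (Fin 3) (Fin 3) ℝ} {a c : ℝ}
    (hA : ∀ i j, |A i j| ≤ a) (hC : ∀ i j, |C i j| ≤ c) (i j : Fin 3) :
    |(A * X * C) i j| ≤ a * c * entrySum X := by
  have ha : 0 ≤ a := (abs_nonneg _).trans (hA 0 0)
  rw [Matrix.mul_apply]
  simp only [Matrix.mul_apply, Finset.sum_mul]
  refine (Finset.abs_sum_le_sum_abs _ _).trans ?_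
  rw [entrySum, Finset.sum_comm, Finset.mul_sum]
  refine Finset.sum_le_sum fun l _ => (Finset.abs_sum_le_sum_abs _ _).trans ?_
  rw [Finset.mul_sum]
  refine Finset.sum_le_sum fun k _ => ?_
  rw [abs_mul, abs_mul]
  calc |A i k| * |X k l| * |C l j| = |A i k| * |C l j| * |X k l| := by ring
    _ ≤ a * c * |X k l| := mul_le_mul_of_nonneg_right
      (mul_le_mul (hA _ _) (hC _ _) (abs_nonneg _) ha) (abs_nonneg _)

theorem frameNorm_smul (y : Frame) (c : ℝ) (ξ : Matrix (Fin 3) (Fin 3) ℝ) :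
    frameNorm y (c • ξ) = |c| * frameNorm y ξ := by
  simp only [frameNorm, Matrix.mul_smul, Matrix.smul_mul, entrySum_smul, Finset.mul_sum]

section UnitColumns

variable {F : Matrix (Fin 3) (Fin 3) ℝ}

theorem abs_le_one_of_unit (hu : ∀ j, ∑ i, F i j ^ 2 = 1) (i j : Fin 3) : |F i j| ≤ 1 := by
  rw [← sq_le_one_iff_abs_le_one, ← hu j]
  exact Finset.single_le_sum (f := fun i => F i j ^ 2) (fun _ _ => sq_nonneg _)
    (Finset.mem_univ i)

theorem projector_frameOf (hF : F.det ≠ 0) (hu : ∀ j, ∑ i, F i j ^ 2 = 1) (j : Fin 3) :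
    projector ((frameOf F hF).1 j) = Matrix.vecMulVec (Fᵀ j) (Fᵀ j) := by
  have h1 : Fᵀ j ⬝ᵥ Fᵀ j = 1 := by
    rw [← hu j]
    exact Finset.sum_congr rfl fun i _ => (sq (F i j)).symm
  refine (projector_mk _ _).trans ?_
  rw [h1, inv_one, one_smul]

/-- For unit columns the projectors sum to `F Fᵀ`. The size of `F⁻¹` is thus a function of the frame
alone, independent of the signs of the columns. -/
theorem trace_inv_sum_projector (hF : F.det ≠ 0) (hu : ∀ j, ∑ i, F i j ^ 2 = 1) :
    (∑ j, projector ((frameOf F hF).1 j))⁻¹.trace = ∑ i, ∑ j, F⁻¹ j i ^ 2 := by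
  have h1 : ∑ j, projector ((frameOf F hF).1 j) = F * Fᵀ := by
    ext i k
    simp only [projector_frameOf hF hu, Matrix.sum_apply, Matrix.vecMulVec_apply,
      Matrix.mul_apply, Matrix.transpose_apply]
  rw [h1, Matrix.mul_inv_rev, ← Matrix.transpose_nonsing_inv, Matrix.trace]
  refine Finset.sum_congr rfl fun i _ => ?_
  rw [Matrix.diag_apply, Matrix.mul_apply]
  exact Finset.sum_congr rfl fun j _ => (sq _).symm

theorem det_sum_projector_ne_zero (y : Frame) : (∑ j, projector (y.1 j)).det ≠ 0 := by
  obtain ⟨F, hF, rfl, hu⟩ := exists_eq_frameOf y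
  have h1 : ∑ j, projector ((frameOf F hF).1 j) = F * Fᵀ := by
    ext i k
    simp only [projector_frameOf hF hu, Matrix.sum_apply, Matrix.vecMulVec_apply,
      Matrix.mul_apply, Matrix.transpose_apply]
  rw [h1, Matrix.det_mul, Matrix.det_transpose]
  exact mul_ne_zero hF hF

/-- The summand of the line `j` suffices: after conjugation by `F` its `(i, j)` entry is exactly
`1`, because the projector has image in column `j` and that column is a unit vector. -/
theorem frameNorm_single_lower (hF : F.det ≠ 0) (hu : ∀ j, ∑ i, F i j ^ 2 = 1) {B : ℝ}
    (hB : ∀ i j, |F⁻¹ i j| ≤ B) {i j : Fin 3} (hij : i ≠ j) :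
    1 ≤ B * frameNorm (frameOf F hF) (F * Matrix.single i j 1 * F⁻¹) := by
  set P := projector ((frameOf F hF).1 j) with hP
  set X := (1 - P) * (F * Matrix.single i j 1 * F⁻¹) * P with hX
  have hB0 : 0 ≤ B := (abs_nonneg _).trans (hB 0 0)
  have hFF := Matrix.nonsing_inv_mul F hF.isUnit
  have hR : F⁻¹ * P * F = Matrix.vecMulVec (Pi.single j 1) (Fᵀ j ᵥ* F) := by
    rw [hP, projector_frameOf hF hu, Matrix.mul_vecMulVec, Matrix.vecMulVec_mul,
      inv_mulVec_col hF]
  have h1 : F⁻¹ * X * F = (1 - F⁻¹ * P * F) * Matrix.single i j 1 * (F⁻¹ * P * F) := by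
    calc F⁻¹ * X * F = (F⁻¹ * (1 - P) * F) * Matrix.single i j 1 * (F⁻¹ * P * F) := by
          simp only [hX, Matrix.mul_assoc]
      _ = _ := by rw [Matrix.mul_sub, Matrix.mul_one, Matrix.sub_mul, hFF]
  have h2 : (F⁻¹ * X * F) i j = 1 := by
    have h3 : (Fᵀ j ᵥ* F) j = 1 := by
      rw [← hu j, Matrix.vecMul, dotProduct]
      exact Finset.sum_congr rfl fun i _ => (sq (F i j)).symm
    rw [h1, hR, Matrix.mul_apply, Finset.sum_eq_single j]
    · rw [Matrix.mul_apply, Finset.sum_eq_single i]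
      · simp [Matrix.vecMulVec_apply, h3, Pi.single_eq_of_ne hij]
      · intro k _ hk
        rw [Matrix.single_apply_of_row_ne (Ne.symm hk), mul_zero]
      · simp
    · intro k _ hk
      rw [Matrix.vecMulVec_apply, Pi.single_eq_of_ne hk, zero_mul, mul_zero]
    · simp
  have h4 := abs_mul_mul_apply_le (X := X) hB (abs_le_one_of_unit hu) i j
  rw [h2, abs_one, mul_one] at h4
  refine h4.trans (mul_le_mul_of_nonneg_left ?_ hB0)
  exact Finset.single_le_sum (f := fun k => entrySum ((1 - projector ((frameOf F hF).1 k)) *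
    (F * Matrix.single i j 1 * F⁻¹) * projector ((frameOf F hF).1 k)))
    (fun _ _ => entrySum_nonneg _) (Finset.mem_univ j)

theorem frameNorm_single_upper (hF : F.det ≠ 0) (hu : ∀ j, ∑ i, F i j ^ 2 = 1) {B : ℝ}
    (hB : ∀ i j, |F⁻¹ i j| ≤ B) (i j : Fin 3) :
    frameNorm (frameOf F hF) (F * Matrix.single i j 1 * F⁻¹) ≤
      3 * (18 * (9 * 9 * (9 * B)) * 9) := by
  have hP : ∀ k a b, |projector ((frameOf F hF).1 k) a b| ≤ 1 := fun k a b => by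
    rw [projector_frameOf hF hu, Matrix.vecMulVec_apply, abs_mul]
    exact mul_le_one₀ (abs_le_one_of_unit hu _ _) (abs_nonneg _) (abs_le_one_of_unit hu _ _)
  have h1P : ∀ k a b, |(1 - projector ((frameOf F hF).1 k)) a b| ≤ 2 := fun k a b => by
    have h1 : |(1 : Matrix (Fin 3) (Fin 3) ℝ) a b| ≤ 1 := by
      rw [Matrix.one_apply]; split_ifs <;> simp
    rw [Matrix.sub_apply]
    linarith [abs_sub ((1 : Matrix (Fin 3) (Fin 3) ℝ) a b) (projector ((frameOf F hF).1 k) a b),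
      hP k a b]
  have hE : ∀ a b, |(Matrix.single i j 1 : Matrix (Fin 3) (Fin 3) ℝ) a b| ≤ 1 := fun a b => by
    rw [Matrix.single_apply]; split_ifs <;> simp
  have hk : ∀ k, entrySum ((1 - projector ((frameOf F hF).1 k)) *
      (F * Matrix.single i j 1 * F⁻¹) * projector ((frameOf F hF).1 k)) ≤
        18 * (9 * 9 * (9 * B)) * 9 := fun k => by
    have e1 := entrySum_le_of_le (hP k)
    have e2 := entrySum_le_of_le (h1P k)
    have e3 := entrySum_le_of_le (abs_le_one_of_unit hu)
    have e4 := entrySum_le_of_le hE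
    have e5 := entrySum_le_of_le hB
    have hB0 : 0 ≤ B := (abs_nonneg _).trans (hB 0 0)
    have f1 : entrySum (F * Matrix.single i j 1) ≤ 9 * 9 :=
      (entrySum_mul_le _ _).trans (mul_le_mul (by linarith) (by linarith) (entrySum_nonneg _)
        (by norm_num))
    have f2 : entrySum (F * Matrix.single i j 1 * F⁻¹) ≤ 9 * 9 * (9 * B) :=
      (entrySum_mul_le _ _).trans (mul_le_mul f1 e5 (entrySum_nonneg _) (by norm_num))
    have f3 : entrySum ((1 - projector ((frameOf F hF).1 k)) *
        (F * Matrix.single i j 1 * F⁻¹)) ≤ 18 * (9 * 9 * (9 * B)) :=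
      (entrySum_mul_le _ _).trans (mul_le_mul (by linarith) f2 (entrySum_nonneg _)
        (by norm_num))
    exact (entrySum_mul_le _ _).trans (mul_le_mul f3 (by linarith) (entrySum_nonneg _)
      (by positivity))
  refine (Finset.sum_le_sum fun k _ => hk k).trans (le_of_eq ?_)
  simp

end UnitColumns

theorem exists_diagonal_of_frameOf_eq {F F' : Matrix (Fin 3) (Fin 3) ℝ} {hF : F.det ≠ 0}
    {hF' : F'.det ≠ 0} (h : frameOf F hF = frameOf F' hF') :
    ∃ m : Fin 3 → ℝ, (∀ j, m j ≠ 0) ∧ F = F' * Matrix.diagonal m := by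
  have h1 : ∀ j, ∃ a : ℝ, a • F'ᵀ j = Fᵀ j := fun j =>
    (Projectivization.mk_eq_mk_iff' ℝ _ _ (col_ne_zero hF j) (col_ne_zero hF' j)).mp
      (congrFun (congrArg Subtype.val h) j)
  choose m hm using h1
  refine ⟨m, fun j h0 => col_ne_zero hF j ?_, ?_⟩
  · rw [← hm j, h0, zero_smul]
  · ext i j
    rw [Matrix.mul_diagonal, mul_comm]
    exact (congrFun (hm j) i).symm

/-! ### The equivariant map `h ↦ φ^{f(h)} ρ₀(h)` -/

/-- The map `h ↦ φ^{f(h)} ρ₀(h)`. -/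
def gauge (f : H → ℝ) (h : H) : G := phi (f h) * rho0 h

theorem continuous_phi : Continuous phi := by
  refine Topology.IsInducing.subtypeVal.continuous_iff.mpr ?_
  change Continuous fun s => (phi s).1
  simp only [phi_eq_diagonal]
  exact Continuous.matrix_diagonal (continuous_pi fun i => by fun_prop)

theorem continuous_gauge {f : H → ℝ} (hf : Continuous f) : Continuous (gauge f) :=
  (continuous_phi.comp hf).mul continuous_rho0

theorem gauge_mul {Γ : Type*} [Group Γ] {ι : Γ →* H} {u : Γ →* Multiplicative ℝ} {f : H → ℝ}
    (hfu : ∀ γ h, f (ι γ * h) = f h + (u γ).toAdd) (γ : Γ) (h : H) :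
    gauge f (ι γ * h) = linearDeformation ι u γ * gauge f h := by
  change phi (f (ι γ * h)) * rho0 (ι γ * h) =
    phi (u γ).toAdd * rho0 (ι γ) * (phi (f h) * rho0 h)
  rw [hfu, add_comm, phi_add, map_mul, mul_assoc, mul_assoc, ← mul_assoc (phi (f h)), phi_comm,
    mul_assoc]

/-- The diagonal entries of `φ^{-x} ρ₀(a^{-t})`. -/
def flowWeight (x t : ℝ) (i : Fin 3) : ℝ :=
  Real.exp (t * aWeight i - x / 3 + x * phiWeight i)

/-- In the trivialization by the gauge, the flow for time `t` becomes a diagonal matrix depending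
only on `t` and the increment of `f`. -/
theorem gauge_inv_mul_gauge (f : H → ℝ) (h : H) (t : ℝ) :
    ((gauge f (h * aFlow t))⁻¹ * gauge f h).1 =
      Matrix.diagonal (flowWeight (f (h * aFlow t) - f h) t) := by
  have h1 : (gauge f (h * aFlow t))⁻¹ * gauge f h =
      rho0 (aFlow (-t)) * phi (-(f (h * aFlow t) - f h)) := by
    rw [inv_mul_eq_iff_eq_mul, gauge, gauge, map_mul, mul_assoc, mul_assoc,
      ← mul_assoc (rho0 (aFlow t)), ← map_mul rho0, ← aFlow_add, add_neg_cancel, aFlow_zero,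
      map_one, one_mul, ← phi_comm, ← mul_assoc, ← phi_add]
    congr 2
    ring
  rw [h1, Matrix.SpecialLinearGroup.coe_mul, rho0_aFlow, phi_eq_diagonal,
    Matrix.diagonal_mul_diagonal]
  congr 1
  funext i
  rw [← Real.exp_add, flowWeight]
  ring_nf

/-! ### Domination along the flow -/

section Domination

variable {Γ : Type*} [Group Γ] {ι : Γ →* H} {u : Γ →* Multiplicative ℝ}

/-- The trace of the inverse of the sum of projectors is continuous and `Γ`-invariant in `h`, hence
bounded by cocompactness: the frames stay uniformly away from degeneration. -/
theorem exists_inv_bound (hι : IsClosedSurfaceEmbedding ι) {g : H → G} {σ : H → Frame}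
    (hg : Continuous g) (hσ : Continuous σ)
    (hinv : ∀ γ h, (g (ι γ * h))⁻¹ • σ (ι γ * h) = (g h)⁻¹ • σ h) :
    ∃ B : ℝ, 1 ≤ B ∧ ∀ (h : H) (F : Matrix (Fin 3) (Fin 3) ℝ) (hF : F.det ≠ 0),
      (∀ j, ∑ i, F i j ^ 2 = 1) → (g h)⁻¹ • σ h = frameOf F hF → ∀ i j, |F⁻¹ i j| ≤ B := by
  set S : H → Matrix (Fin 3) (Fin 3) ℝ := fun h => ∑ j, projector (((g h)⁻¹ • σ h).1 j) with hS
  have hSc : Continuous S := continuous_finsetSum _ fun j _ =>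
    continuous_projector_smul hg.inv hσ j
  have hdet : ∀ h, (S h).det ≠ 0 := fun h => det_sum_projector_ne_zero _
  have hSi : Continuous fun h => (S h)⁻¹.trace := by
    have : ∀ h, (S h)⁻¹ = (S h).det⁻¹ • (S h).adjugate := fun h => by
      rw [Matrix.inv_def, Ring.inverse_eq_inv']
    simp only [this]
    exact ((hSc.matrix_det.inv₀ hdet).smul hSc.matrix_adjugate).matrix_trace
  obtain ⟨C, hC, hCb⟩ := exists_abs_le_of_invariant hι hSi fun γ h => by
    simp only [hS, hinv]
  refine ⟨C + 1, by linarith, fun h F hF hu e i j => ?_⟩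
  have h1 := (le_abs_self _).trans (hCb h)
  simp only [hS, e] at h1
  rw [trace_inv_sum_projector hF hu] at h1
  have h2 : F⁻¹ i j ^ 2 ≤ ∑ i, ∑ j, F⁻¹ j i ^ 2 :=
    (Finset.single_le_sum (f := fun i => F⁻¹ i j ^ 2) (fun _ _ => sq_nonneg _)
      (Finset.mem_univ i)).trans (Finset.single_le_sum (f := fun j => ∑ i, F⁻¹ i j ^ 2)
        (fun _ _ => Finset.sum_nonneg fun _ _ => sq_nonneg _) (Finset.mem_univ j))
  refine abs_le_of_sq_le_sq (by nlinarith) (by linarith)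

/-- If `D` stretches the `j`-th vector by `m j`, it stretches the elementary tangent vector from
line `j` to line `i` by `m i / m j`. Contraction of tangent vectors thereby becomes domination
between lines. -/
theorem conj_single_eq {F F' : Matrix (Fin 3) (Fin 3) ℝ} (hF : F.det ≠ 0) (hF' : F'.det ≠ 0)
    {D : G} {m : Fin 3 → ℝ} (hm : ∀ j, m j ≠ 0) (h : D.1 * F = F' * Matrix.diagonal m)
    (i j : Fin 3) :
    D.1 * (F * Matrix.single i j 1 * F⁻¹) * D⁻¹.1 =
      (m i / m j) • (F' * Matrix.single i j 1 * F'⁻¹) := by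
  have hFF := Matrix.mul_nonsing_inv F hF.isUnit
  have hFF' := Matrix.nonsing_inv_mul F' hF'.isUnit
  have hdiag : Matrix.diagonal (fun j => (m j)⁻¹) * Matrix.diagonal m =
      (1 : Matrix (Fin 3) (Fin 3) ℝ) := by
    rw [Matrix.diagonal_mul_diagonal, ← Matrix.diagonal_one]
    congr 1
    exact funext fun j => inv_mul_cancel₀ (hm j)
  have h1 : F⁻¹ * D⁻¹.1 = Matrix.diagonal (fun j => (m j)⁻¹) * F'⁻¹ := by
    have h2 : (Matrix.diagonal (fun j => (m j)⁻¹) * F'⁻¹) * (D.1 * F) = 1 := by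
      rw [h, Matrix.mul_assoc, ← Matrix.mul_assoc F'⁻¹, hFF', Matrix.one_mul, hdiag]
    have h3 : (D.1 * F) * (F⁻¹ * D⁻¹.1) = 1 := by
      rw [Matrix.mul_assoc, ← Matrix.mul_assoc F, hFF, Matrix.one_mul, coe_mul_inv_cancel]
    exact (left_inv_eq_right_inv h2 h3).symm
  calc D.1 * (F * Matrix.single i j 1 * F⁻¹) * D⁻¹.1
      = (D.1 * F) * Matrix.single i j 1 * (F⁻¹ * D⁻¹.1) := by simp only [Matrix.mul_assoc]
    _ = F' * (Matrix.diagonal m * Matrix.single i j 1 *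
          Matrix.diagonal (fun j => (m j)⁻¹)) * F'⁻¹ := by
        rw [h1, h]; simp only [Matrix.mul_assoc]
    _ = F' * ((m i / m j) • Matrix.single i j 1) * F'⁻¹ := by
        congr 2
        ext a b
        rw [Matrix.mul_diagonal, Matrix.diagonal_mul, Matrix.smul_apply, Matrix.single_apply,
          smul_eq_mul]
        split_ifs with hab
        · rw [← hab.1, ← hab.2]; ring
        · simp
    _ = _ := by rw [Matrix.mul_smul, Matrix.smul_mul]

theorem single_conj_eq {F : Matrix (Fin 3) (Fin 3) ℝ} (hF : F.det ≠ 0) (g : G) (i j : Fin 3) :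
    (g.1 * F)⁻¹ * (g.1 * (F * Matrix.single i j 1 * F⁻¹) * g⁻¹.1) * (g.1 * F) =
      Matrix.single i j 1 := by
  have hFF := Matrix.nonsing_inv_mul F hF.isUnit
  rw [Matrix.mul_inv_rev, coe_inv_eq]
  calc _ = F⁻¹ * (g⁻¹.1 * (g.1 * (F * Matrix.single i j 1 * F⁻¹) * g⁻¹.1) * g.1) * F := by
        simp only [Matrix.mul_assoc]
    _ = (F⁻¹ * F) * Matrix.single i j 1 * (F⁻¹ * F) := by
        rw [inv_conj_conj]; simp only [Matrix.mul_assoc]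
    _ = _ := by rw [hFF, Matrix.one_mul, Matrix.mul_one]

/-- In the coordinates given by the gauge, the section of an Anosov structure is a frame whose
lines are stretched at different exponential rates by the flow. -/
theorem exists_dominated_frame (hι : IsClosedSurfaceEmbedding ι)
    {s : M ι → E ι (linearDeformation ι u)} (hs : IsAnosovSection ι (linearDeformation ι u) s)
    {f : H → ℝ} (hf : Continuous f) (hfu : ∀ γ h, f (ι γ * h) = f h + (u γ).toAdd) :
    ∃ a : ℝ, 0 < a ∧ a < 1 ∧ ∃ C : ℝ, 1 ≤ C ∧ ∀ h : H, ∃ F : Matrix (Fin 3) (Fin 3) ℝ,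
      F.det ≠ 0 ∧ (∀ i j, |F i j| ≤ 1) ∧ (∀ i j, |F⁻¹ i j| ≤ C) ∧
      ∀ t : ℝ, ∃ m : Fin 3 → ℝ, (∀ j, 0 < m j) ∧
        (∀ i j, flowWeight (f (h * aFlow t) - f h) t i * |F i j| ≤ m j) ∧
        (∀ i j, m j * |F⁻¹ j i| ≤ C * flowWeight (f (h * aFlow t) - f h) t i) ∧
        (0 < t → ∀ i j, i < j → m i ≤ C * Real.exp (-a * t) * m j) ∧
        (t < 0 → ∀ i j, j < i → m i ≤ C * Real.exp (a * t) * m j) := by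
  obtain ⟨σ, hσc, hσγ, hσt, hσs⟩ := exists_lift_section hι hs.continuous hs.isSection hs.invariant
  have hg := continuous_gauge hf
  have heq := gauge_mul hfu
  obtain ⟨B, hB1, hB⟩ := exists_inv_bound hι hg hσc fun γ h => by
    rw [heq, hσγ, mul_inv_rev, mul_smul, inv_smul_smul]
  obtain ⟨a₀, ha₀, b, hb, hyp⟩ := hs.hyperbolic (equivariantNorm ι _ (gauge f) hg heq)
  choose F hF hFσ hFu using fun h => exists_eq_frameOf ((gauge f h)⁻¹ • σ h)
  have hFB := fun h => hB h (F h) (hF h) (hFu h) (hFσ h)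
  -- Lowering the rate only ensures `a < 1`.
  set a := min a₀ (1 / 2)
  have ha : 0 < a := lt_min ha₀ (by norm_num)
  have haa : a ≤ a₀ := min_le_left _ _
  set U : ℝ := 3 * (18 * (9 * 9 * (9 * B)) * 9)
  have hU : 0 ≤ U := by positivity
  set C := max B (B * b * U)
  have hBC : B ≤ C := le_max_left _ _
  have hUC : B * b * U ≤ C := le_max_right _ _
  refine ⟨a, ha, (min_le_right _ _).trans_lt (by norm_num), C, hB1.trans hBC, fun h =>
    ⟨F h, hF h, abs_le_one_of_unit (hFu h), fun i j => (hFB h i j).trans hBC, fun t => ?_⟩⟩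
  set d := flowWeight (f (h * aFlow t) - f h) t with hd
  have hdpos : ∀ i, 0 < d i := fun i => Real.exp_pos _
  set h' := h * aFlow t with hh'
  set D : G := (gauge f h')⁻¹ * gauge f h with hD
  have hDd : D.1 = Matrix.diagonal d := gauge_inv_mul_gauge f h t
  -- The lifted section is constant along the flow, so the two gauged frames differ by `D`; their
  -- matrices then differ by column factors `m`, the stretching factors.
  have hframe : frameOf (D.1 * F h) (det_coe_mul_ne_zero D (hF h)) = frameOf (F h') (hF h') := by
    rw [← smul_frameOf D (hF h), ← hFσ, ← hFσ, hD, mul_smul, smul_inv_smul, hh', hσt]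
  obtain ⟨m, hm0, hm⟩ := exists_diagonal_of_frameOf_eq hframe
  have hm2 : (F h')⁻¹ * Matrix.diagonal d = Matrix.diagonal m * (F h)⁻¹ := by
    have h1 : (F h')⁻¹ * (D.1 * F h) * (F h)⁻¹ = Matrix.diagonal m * (F h)⁻¹ := by
      rw [hm, ← Matrix.mul_assoc, Matrix.nonsing_inv_mul _ (hF h').isUnit, Matrix.one_mul]
    rw [← h1, hDd, Matrix.mul_assoc, Matrix.mul_assoc, Matrix.mul_nonsing_inv _ (hF h).isUnit,
      Matrix.mul_one]
  have hcontr : ∀ i j, i ≠ j → ∀ τ : ℝ,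
      (equivariantNorm ι _ (gauge f) hg heq).val h' (σ h)
          ((gauge f h).1 * (F h * Matrix.single i j 1 * (F h)⁻¹) * (gauge f h)⁻¹.1) ≤
        b * Real.exp (-a₀ * τ) * (equivariantNorm ι _ (gauge f) hg heq).val h (σ h)
          ((gauge f h).1 * (F h * Matrix.single i j 1 * (F h)⁻¹) * (gauge f h)⁻¹.1) →
      0 < τ → |m i| ≤ C * Real.exp (-a * τ) * |m j| := by
    intro i j hij τ hle hτ
    rw [equivariantNorm_val, equivariantNorm_val, inv_conj_conj] at hle
    have e1 : (gauge f h')⁻¹.1 *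
        ((gauge f h).1 * (F h * Matrix.single i j 1 * (F h)⁻¹) * (gauge f h)⁻¹.1) *
          (gauge f h').1 = (m i / m j) • (F h' * Matrix.single i j 1 * (F h')⁻¹) := by
      rw [← conj_single_eq (hF h) (hF h') hm0 hm i j, hD, mul_conj, inv_inv]
    have e2 : (gauge f h')⁻¹ • σ h = frameOf (F h') (hF h') := by
      rw [← hFσ, hh', hσt]
    rw [e1, e2, frameNorm_smul, hFσ h] at hle
    have h1 := frameNorm_single_lower (hF h') (hFu h') (hFB h') hij
    have h2 := frameNorm_single_upper (hF h) (hFu h) (hFB h) i j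
    have h3 : Real.exp (-a₀ * τ) ≤ Real.exp (-a * τ) := Real.exp_le_exp.mpr (by nlinarith)
    have hmj : 0 < |m j| := abs_pos.mpr (hm0 j)
    set n' := frameNorm (frameOf (F h') (hF h')) (F h' * Matrix.single i j 1 * (F h')⁻¹)
    have h4 : |m i / m j| ≤ C * Real.exp (-a * τ) := by
      calc |m i / m j| = |m i / m j| * 1 := (mul_one _).symm
        _ ≤ |m i / m j| * (B * n') := mul_le_mul_of_nonneg_left h1 (abs_nonneg _)
        _ = B * (|m i / m j| * n') := by ring
        _ ≤ B * (b * Real.exp (-a₀ * τ) * U) := by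
            refine mul_le_mul_of_nonneg_left (hle.trans ?_) (by linarith)
            exact mul_le_mul_of_nonneg_left h2 (by positivity)
        _ = B * b * U * Real.exp (-a₀ * τ) := by ring
        _ ≤ C * Real.exp (-a * τ) := mul_le_mul hUC h3 (Real.exp_pos _).le
            (by linarith)
    rw [abs_div, div_le_iff₀ hmj] at h4
    exact h4
  have hmem : Quotient.mk (bundleSetoid ι (linearDeformation ι u)) (h, σ h) ∈ Set.range s :=
    ⟨_, (hσs h).symm⟩
  have hσF : σ h = frameOf ((gauge f h).1 * F h) (det_coe_mul_ne_zero _ (hF h)) := by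
    rw [← smul_frameOf _ (hF h), ← hFσ, smul_inv_smul]
  refine ⟨fun j => |m j|, fun j => abs_pos.mpr (hm0 j), fun i j => ?_, fun i j => ?_,
    fun ht i j hij => ?_, fun ht i j hij => ?_⟩
  · have h1 := congrFun (congrFun hm i) j
    rw [hDd, Matrix.diagonal_mul, Matrix.mul_diagonal] at h1
    have h2 := congrArg abs h1
    rw [abs_mul, abs_mul, abs_of_pos (hdpos i)] at h2
    rw [h2]
    exact mul_le_of_le_one_left (abs_nonneg _) (abs_le_one_of_unit (hFu h') i j)
  · have h1 := congrFun (congrFun hm2 j) i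
    rw [Matrix.diagonal_mul, Matrix.mul_diagonal] at h1
    have h2 := congrArg abs h1
    rw [abs_mul, abs_mul, abs_of_pos (hdpos i)] at h2
    rw [← h2]
    exact mul_le_mul_of_nonneg_right ((hFB h' j i).trans hBC) (hdpos i).le
  · refine hcontr i j hij.ne t ((hyp h (σ h) hmem t ht).1 _ ⟨_, ?_, rfl⟩) ht
    rw [hσF]
    refine (mem_flagIsotropy_piPlus _ _).mpr fun i' j' hji => ?_
    rw [single_conj_eq (hF h), Matrix.single_apply, if_neg]
    rintro ⟨rfl, rfl⟩
    exact lt_asymm hij hji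
  · have h1 := (hyp h (σ h) hmem (-t) (by linarith)).2
    rw [neg_neg] at h1
    have h2 := hcontr i j hij.ne' (-t) (h1 _ ⟨_, ?_, rfl⟩) (by linarith)
    · rwa [neg_mul_neg] at h2
    rw [hσF]
    refine (mem_flagIsotropy_piMinus _ _).mpr fun i' j' hji => ?_
    rw [single_conj_eq (hF h), Matrix.single_apply, if_neg]
    rintro ⟨rfl, rfl⟩
    exact lt_asymm hij hji

/-- A frame dominated in both time directions by a diagonal flow is a permutation of the
coordinate frame. -/
theorem exists_permutation_of_dominated {F : Matrix (Fin 3) (Fin 3) ℝ} (hF : F.det ≠ 0)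
    {a C : ℝ} (ha : 0 < a) (hC : 1 ≤ C) (hF1 : ∀ i j, |F i j| ≤ 1)
    (hFC : ∀ i j, |F⁻¹ i j| ≤ C) {d : ℝ → Fin 3 → ℝ}
    (hdom : ∀ t : ℝ, ∃ m : Fin 3 → ℝ, (∀ j, 0 < m j) ∧
        (∀ i j, d t i * |F i j| ≤ m j) ∧ (∀ i j, m j * |F⁻¹ j i| ≤ C * d t i) ∧
        (0 < t → ∀ i j, i < j → m i ≤ C * Real.exp (-a * t) * m j) ∧
        (t < 0 → ∀ i j, j < i → m i ≤ C * Real.exp (a * t) * m j)) :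
    ∃ τ : Fin 3 → Fin 3, Function.Injective τ ∧ ∀ t : ℝ, 0 < t → ∀ i j, τ i < τ j →
      d t i ≤ C ^ 3 * Real.exp (-a * t) * d t j := by
  have hdecay : ∀ x : ℝ, 0 ≤ x → (∀ t : ℝ, 0 < t → x ≤ C * (C * Real.exp (-a * t))) → x = 0 := by
    intro x hx h
    refine le_antisymm ?_ hx
    have h1 : Tendsto (fun t : ℝ => C * (C * Real.exp (-a * t))) atTop (𝓝 0) := by
      have h2 : Tendsto (fun t : ℝ => Real.exp (-a * t)) atTop (𝓝 0) := by
        refine Real.tendsto_exp_atBot.comp ?_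
        exact tendsto_id.const_mul_atTop_of_neg (by linarith)
      have h3 := (h2.const_mul C).const_mul C
      simpa using h3
    refine ge_of_tendsto h1 ?_
    filter_upwards [eventually_gt_atTop 0] with t ht using h t ht
  -- The time direction is chosen by the order of `j` and `k` so that `m j` is exponentially smaller
  -- than `m k`. Bounding `d i` below through `F⁻¹ k i` and above through `F i j` makes the product
  -- decay to zero.
  have key : ∀ i j k, k ≠ j → F i j * F⁻¹ k i = 0 := by
    intro i j k hkj
    rw [← abs_eq_zero]
    refine hdecay _ (abs_nonneg _) fun t ht => ?_
    have hC0 : 0 ≤ C := by linarith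
    have hstep : ∀ t' : ℝ, ∀ m : Fin 3 → ℝ, (∀ j, 0 < m j) →
        (∀ i j, d t' i * |F i j| ≤ m j) → (∀ i j, m j * |F⁻¹ j i| ≤ C * d t' i) →
        m j ≤ C * Real.exp (-a * t) * m k → |F i j * F⁻¹ k i| ≤ C * (C * Real.exp (-a * t)) := by
      intro t' m hm h1 h2 h3
      have h4 : m k * |F i j * F⁻¹ k i| ≤ m k * (C * (C * Real.exp (-a * t))) := by
        calc m k * |F i j * F⁻¹ k i| = (m k * |F⁻¹ k i|) * |F i j| := by rw [abs_mul]; ring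
          _ ≤ C * d t' i * |F i j| := mul_le_mul_of_nonneg_right (h2 i k) (abs_nonneg _)
          _ = C * (d t' i * |F i j|) := by ring
          _ ≤ C * (C * Real.exp (-a * t) * m k) :=
            mul_le_mul_of_nonneg_left ((h1 i j).trans h3) hC0
          _ = _ := by ring
      exact le_of_mul_le_mul_left h4 (hm k)
    rcases lt_or_gt_of_ne hkj with hlt | hgt
    · obtain ⟨m, hm, h1, h2, -, h3⟩ := hdom (-t)
      refine hstep _ m hm h1 h2 ((h3 (by linarith) j k hlt).trans (le_of_eq ?_))
      rw [mul_neg, neg_mul]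
    · obtain ⟨m, hm, h1, h2, h3, -⟩ := hdom t
      exact hstep _ m hm h1 h2 (h3 ht j k hgt)
  have hFF := Matrix.mul_nonsing_inv F hF.isUnit
  have hex : ∀ i, ∃ j, F i j * F⁻¹ j i ≠ 0 := by
    intro i
    by_contra! hcon
    have h1 := congrFun (congrFun hFF i) i
    rw [Matrix.mul_apply, Finset.sum_eq_zero fun j _ => hcon j, Matrix.one_apply_eq] at h1
    exact zero_ne_one h1
  -- By `key`, `F⁻¹ E_ii F` is a diagonal matrix. It has rank one and trace one, so one diagonal
  -- entry survives, at position `τ i`.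
  choose τ hτ using hex
  have hsum : ∀ i i', F i (τ i) * F⁻¹ (τ i) i' = (1 : Matrix (Fin 3) (Fin 3) ℝ) i i' := by
    intro i i'
    rw [← hFF, Matrix.mul_apply, Finset.sum_eq_single (τ i)]
    · intro k _ hk
      have h1 := key i k (τ i) hk.symm
      rw [(mul_eq_zero.mp h1).resolve_right (right_ne_zero_of_mul (hτ i)), zero_mul]
    · simp
  refine ⟨τ, fun i i' hii => ?_, fun t ht i j hij => ?_⟩
  · by_contra hne
    have h1 := hsum i i'
    rw [Matrix.one_apply_ne hne] at h1
    rcases mul_eq_zero.mp h1 with h2 | h2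
    · exact left_ne_zero_of_mul (hτ i) h2
    · rw [hii] at h2
      exact right_ne_zero_of_mul (hτ i') h2
  · obtain ⟨m, hm, h1, h2, h3, -⟩ := hdom t
    have hC0 : 0 < C := by linarith
    have e : ∀ i, |F i (τ i)| * |F⁻¹ (τ i) i| = 1 := fun i => by
      rw [← abs_mul, hsum, Matrix.one_apply_eq, abs_one]
    have hlow : d t i ≤ C * m (τ i) := by
      calc d t i = (d t i * |F i (τ i)|) * |F⁻¹ (τ i) i| := by rw [mul_assoc, e, mul_one]
        _ ≤ m (τ i) * C := mul_le_mul (h1 _ _) (hFC _ _) (abs_nonneg _) (hm _).le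
        _ = _ := mul_comm _ _
    have hup : m (τ j) ≤ C * d t j := by
      have h5 : 1 ≤ |F⁻¹ (τ j) j| := by
        rw [← e j]
        exact mul_le_of_le_one_left (abs_nonneg _) (hF1 _ _)
      exact (le_mul_of_one_le_right (hm _).le h5).trans (h2 j (τ j))
    calc d t i ≤ C * m (τ i) := hlow
      _ ≤ C * (C * Real.exp (-a * t) * m (τ j)) :=
        mul_le_mul_of_nonneg_left (h3 ht _ _ hij) hC0.le
      _ ≤ C * (C * Real.exp (-a * t) * (C * d t j)) :=
        mul_le_mul_of_nonneg_left (mul_le_mul_of_nonneg_left hup (by positivity)) hC0.le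
      _ = _ := by ring

/-- Along each orbit, the increments of `f` are in one of three regimes. -/
theorem exists_trichotomy (hι : IsClosedSurfaceEmbedding ι)
    (hA : IsAnosov ι (linearDeformation ι u))
    {f : H → ℝ} (hf : Continuous f) (hfu : ∀ γ h, f (ι γ * h) = f h + (u γ).toAdd) :
    ∃ a : ℝ, 0 < a ∧ a < 1 ∧ ∃ C : ℝ, ∀ h : H,
      (∀ t > 0, |f (h * aFlow t) - f h| ≤ (1 - a) * t + C) ∨
      (∀ t > 0, (1 + a) * t - C ≤ f (h * aFlow t) - f h) ∨
      (∀ t > 0, f (h * aFlow t) - f h ≤ -((1 + a) * t) + C) := by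
  obtain ⟨s, hs⟩ := hA
  obtain ⟨a, ha, ha1, C, hC, hdom⟩ := exists_dominated_frame hι hs hf hfu
  obtain ⟨c, hc⟩ : ∃ c, c = Real.log (C ^ 3) := ⟨_, rfl⟩
  refine ⟨a, ha, ha1, c, fun h => ?_⟩
  obtain ⟨F, hF, hF1, hFC, hFd⟩ := hdom h
  obtain ⟨τ, hτ, hτd⟩ := exists_permutation_of_dominated hF ha hC hF1 hFC
    (d := fun t => flowWeight (f (h * aFlow t) - f h) t) hFd
  have hlog : ∀ t > 0, ∀ i j, τ i < τ j →
      t * aWeight i + (f (h * aFlow t) - f h) * phiWeight i ≤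
        c - a * t + (t * aWeight j + (f (h * aFlow t) - f h) * phiWeight j) := by
    intro t ht i j hij
    have h0 := hτd t ht i j hij
    simp only [flowWeight] at h0
    have h1 := Real.log_le_log (Real.exp_pos _) h0
    rw [Real.log_mul (by positivity) (Real.exp_pos _).ne', Real.log_mul (by positivity)
      (Real.exp_pos _).ne', Real.log_exp, Real.log_exp, Real.log_exp, ← hc] at h1
    linarith
  -- The opposite order would give `(2 + a)t ≤ c` for all `t > 0`, which fails at `t = |c| + 1`. The
  -- three regimes are the possible positions of `τ 1`.
  have h02 : τ 0 < τ 2 := by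
    rcases lt_or_gt_of_ne (hτ.ne (by decide : (0 : Fin 3) ≠ 2)) with h | h
    · exact h
    · have h1 := hlog (|c| + 1) (by positivity) 2 0 h
      simp [aWeight, phiWeight] at h1
      nlinarith [le_abs_self c, abs_nonneg c]
  rcases lt_or_gt_of_ne (hτ.ne (by decide : (0 : Fin 3) ≠ 1)) with h01 | h01
  · rcases lt_or_gt_of_ne (hτ.ne (by decide : (1 : Fin 3) ≠ 2)) with h12 | h12
    · refine Or.inl fun t ht => ?_
      have h1 := hlog t ht 0 1 h01
      have h2 := hlog t ht 1 2 h12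
      simp [aWeight, phiWeight] at h1 h2
      exact abs_le.mpr ⟨by linarith, by linarith⟩
    · refine Or.inr (Or.inl fun t ht => ?_)
      have h1 := hlog t ht 2 1 h12
      simp [aWeight, phiWeight] at h1
      linarith
  · refine Or.inr (Or.inr fun t ht => ?_)
    have h1 := hlog t ht 1 0 h01
    simp [aWeight, phiWeight] at h1
    linarith

end Domination

/-! ### Rotations and the Cartan decomposition -/

/-- The rotation of angle `θ`. -/
def rot (θ : ℝ) : H :=
  ⟨!![Real.cos θ, -Real.sin θ; Real.sin θ, Real.cos θ], by
    rw [Matrix.det_fin_two_of]; nlinarith [Real.sin_sq_add_cos_sq θ]⟩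

theorem continuous_rot : Continuous rot := by
  refine Topology.IsInducing.subtypeVal.continuous_iff.mpr ?_
  refine continuous_matrix fun i j => ?_
  change Continuous fun θ => (rot θ).1 i j
  fin_cases i <;> fin_cases j <;> simp [rot] <;> fun_prop

theorem rot_zero : rot 0 = 1 := by
  ext i j
  fin_cases i <;> fin_cases j <;> simp [rot]

theorem rot_half_pi_mul_aFlow (t : ℝ) :
    rot (Real.pi / 2) * aFlow t = aFlow (-t) * rot (Real.pi / 2) := by
  refine Subtype.ext ?_
  rw [Matrix.SpecialLinearGroup.coe_mul, Matrix.SpecialLinearGroup.coe_mul]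
  ext i j
  fin_cases i <;> fin_cases j <;> simp [rot, aFlow, Matrix.mul_apply, Fin.sum_univ_two]

theorem abs_rot_le (θ : ℝ) (i j : Fin 2) : |rot θ i j| ≤ 1 := by
  fin_cases i <;> fin_cases j <;> simp [rot, Real.abs_sin_le_one, Real.abs_cos_le_one]

theorem abs_rot_inv_le (θ : ℝ) (i j : Fin 2) : |(rot θ)⁻¹ i j| ≤ 1 := by
  rw [Matrix.SpecialLinearGroup.coe_inv, Matrix.adjugate_fin_two]
  fin_cases i <;> fin_cases j <;> simp [rot, Real.abs_sin_le_one, Real.abs_cos_le_one]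

/-- The Cartan decomposition of `SL(2,ℝ)`. -/
theorem exists_cartan (A : H) : ∃ θ ∈ Set.Icc (-Real.pi) Real.pi,
    ∃ ψ ∈ Set.Icc (-Real.pi) Real.pi, ∃ t : ℝ, A * rot θ = rot ψ * aFlow t := by
  set q : ℝ → ℝ := fun θ => (A * rot θ).1 0 0 * (A * rot θ).1 0 1 +
    (A * rot θ).1 1 0 * (A * rot θ).1 1 1 with hq
  have hqc : Continuous q := by
    have h1 : Continuous fun θ => (A * rot θ).1 :=
      continuous_subtype_val.comp (continuous_const.mul continuous_rot)
    have h2 : ∀ i j, Continuous fun θ => (A * rot θ).1 i j := fun i j => h1.matrix_elem i j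
    exact ((h2 0 0).mul (h2 0 1)).add ((h2 1 0).mul (h2 1 1))
  have hpi := Real.pi_pos
  -- `q` is the inner product of the columns of `A rot θ`. A quarter turn exchanges them up to a
  -- sign, so they are orthogonal for some intermediate `θ`; then the first column gives `ψ` and
  -- `e^t`, and the determinant fixes the second.
  have hq2 : q (Real.pi / 2) = -q 0 := by
    simp only [hq, Matrix.SpecialLinearGroup.coe_mul, Matrix.mul_apply, Fin.sum_univ_two]
    simp [rot]
    ring
  obtain ⟨θ, hθ, hθ0⟩ : ∃ θ ∈ Set.Icc 0 (Real.pi / 2), q θ = 0 := by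
    rcases le_total 0 (q 0) with h | h
    · exact intermediate_value_Icc' (by positivity) hqc.continuousOn ⟨by linarith, h⟩
    · exact intermediate_value_Icc (by positivity) hqc.continuousOn ⟨h, by linarith⟩
  obtain ⟨X, hX⟩ : ∃ X, X = A * rot θ := ⟨_, rfl⟩
  have hdet := X.2
  rw [Matrix.det_fin_two] at hdet
  have horth : X.1 0 0 * X.1 0 1 + X.1 1 0 * X.1 1 1 = 0 := by rw [hX]; exact hθ0
  generalize hx : X.1 0 0 = x at hdet horth
  generalize hy : X.1 1 0 = y at hdet horth
  have hxy : 0 < x ^ 2 + y ^ 2 := by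
    rcases eq_or_ne x 0 with h0 | h0
    · have : y ≠ 0 := by rintro h; rw [h0, h] at hdet; simp at hdet
      positivity
    · positivity
  have hz : X.1 0 1 * (x ^ 2 + y ^ 2) = -y := by
    linear_combination x * horth - y * hdet
  have hw : X.1 1 1 * (x ^ 2 + y ^ 2) = x := by
    linear_combination y * horth + x * hdet
  set r := Real.sqrt (x ^ 2 + y ^ 2) with hr
  have hr0 : 0 < r := Real.sqrt_pos.mpr hxy
  have hrr : r * r = x ^ 2 + y ^ 2 := Real.mul_self_sqrt hxy.le
  set z : ℂ := ⟨x, y⟩ with hzdef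
  have hnorm : ‖z‖ = r := by
    rw [Complex.norm_def, Complex.normSq_apply, hr]; congr 1; ring
  have hz0 : z ≠ 0 := norm_pos_iff.mp (hnorm ▸ hr0)
  refine ⟨θ, ⟨by linarith [hθ.1], by linarith [hθ.2]⟩, Complex.arg z,
    ⟨(Complex.neg_pi_lt_arg z).le, Complex.arg_le_pi z⟩, Real.log r, ?_⟩
  have hcos : Real.cos (Complex.arg z) = x / r := by rw [Complex.cos_arg hz0, hnorm]
  have hsin : Real.sin (Complex.arg z) = y / r := by rw [Complex.sin_arg, hnorm]
  have hz' : X.1 0 1 = -y / (r * r) := by rw [hrr, eq_div_iff hxy.ne', hz]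
  have hw' : X.1 1 1 = x / (r * r) := by rw [hrr, eq_div_iff hxy.ne', hw]
  rw [← hX]
  refine Subtype.ext ?_
  rw [Matrix.SpecialLinearGroup.coe_mul]
  ext i j
  rw [Matrix.mul_apply, Fin.sum_univ_two]
  fin_cases i <;> fin_cases j
  · simp [rot, aFlow, hcos, Real.exp_log hr0, hr0.ne', hx]
  · simp [rot, aFlow, hsin, Real.exp_neg, Real.exp_log hr0, hz', div_eq_mul_inv, mul_assoc]
  · simp [rot, aFlow, hsin, Real.exp_log hr0, hr0.ne', hy]
  · simp [rot, aFlow, hcos, Real.exp_neg, Real.exp_log hr0, hw', div_eq_mul_inv, mul_assoc]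

/-! ### The Anosov property bounds the periods -/

/-- If the increments of `f` are in one of three regimes along each orbit, and right translation
by rotations moves `f` by a bounded amount, then the fastest growing regime does not occur. -/
theorem not_fast_regime {f : H → ℝ} (hf : Continuous f) {a C B : ℝ} (ha : 0 < a)
    (htri : ∀ h : H, (∀ t > 0, |f (h * aFlow t) - f h| ≤ (1 - a) * t + C) ∨
      (∀ t > 0, (1 + a) * t - C ≤ f (h * aFlow t) - f h) ∨
      (∀ t > 0, f (h * aFlow t) - f h ≤ -((1 + a) * t) + C))
    (hB : ∀ h, |f (h * rot (Real.pi / 2)) - f h| ≤ B) (h₀ : H) :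
    ¬ ∀ t > 0, (1 + a) * t - C ≤ f (h₀ * aFlow t) - f h₀ := by
  intro hfast
  have hC0 := abs_nonneg C
  have hC1 := le_abs_self C
  -- At this time `a t₀ > C`, so the increment is above `t₀` in the fast regime and below `t₀` in
  -- the others. It never equals `t₀`, hence the intermediate value theorem keeps the regime along a
  -- path.
  set t₀ := (|C| + 1) / a with ht₀
  have hat : a * t₀ = |C| + 1 := mul_div_cancel₀ _ ha.ne'
  have ht₀pos : 0 < t₀ := by positivity
  have hprop : ∀ p : ℝ → H, Continuous p → p 0 = h₀ → ∀ x,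
      ∀ t > 0, (1 + a) * t - C ≤ f (p x * aFlow t) - f (p x) := by
    intro p hp hp0 x
    set q : ℝ → ℝ := fun x => f (p x * aFlow t₀) - f (p x) with hq
    have hqc : Continuous q := (hf.comp (hp.mul continuous_const)).sub (hf.comp hp)
    have hq0 : t₀ ≤ q 0 := by
      have := hfast t₀ ht₀pos
      simp only [hq, hp0]
      nlinarith
    have hne : ∀ x, q x ≠ t₀ := by
      intro x
      rcases htri (p x) with h | h | h
      · have h1 := le_of_abs_le (h t₀ ht₀pos)
        exact ne_of_lt (lt_of_le_of_lt h1 (by nlinarith))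
      · exact ne_of_gt (lt_of_lt_of_le (by nlinarith) (h t₀ ht₀pos))
      · exact ne_of_lt (lt_of_le_of_lt (h t₀ ht₀pos) (by nlinarith))
    have hqx : t₀ ≤ q x := by
      by_contra hcon
      obtain ⟨x', hx'⟩ := mem_range_of_exists_le_of_exists_ge hqc ⟨x, (not_le.mp hcon).le⟩ ⟨0, hq0⟩
      exact hne x' hx'
    rcases htri (p x) with h | h | h
    · have h1 := le_of_abs_le (h t₀ ht₀pos)
      exact absurd (hqx.trans h1) (not_le.mpr (by nlinarith))
    · exact h
    · exact absurd (hqx.trans (h t₀ ht₀pos)) (not_le.mpr (by nlinarith))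
  have hBnn : 0 ≤ B := (abs_nonneg _).trans (hB h₀)
  set T := |C| + B + 1 with hT
  have hTpos : 0 < T := by positivity
  -- Fast growth holds at `h₀ rot(π/2)` and at `h₀ a^{-T}`. Since `rot(π/2) a^T = a^{-T} rot(π/2)`,
  -- the first forces `f` to be large near `h₀ a^{-T}` and the second forces it to be small there;
  -- `T > |C| + B` makes these incompatible.
  have h1 := hprop (fun θ => h₀ * rot θ) (continuous_const.mul continuous_rot)
    (by simp only [rot_zero, mul_one]) (Real.pi / 2) T hTpos
  have h2 := hprop (fun t => h₀ * aFlow t) (continuous_const.mul continuous_aFlow)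
    (by simp only [aFlow_zero, mul_one]) (-T) T hTpos
  simp only [mul_assoc] at h1 h2
  rw [rot_half_pi_mul_aFlow, ← mul_assoc] at h1
  rw [← aFlow_add, neg_add_cancel, aFlow_zero, mul_one] at h2
  have h3 := le_of_abs_le (hB (h₀ * aFlow (-T)))
  have h4 := neg_le_of_abs_le (hB h₀)
  nlinarith

section Periods

variable {Γ : Type*} [Group Γ] {ι : Γ →* H} {u : Γ →* Multiplicative ℝ}

/-- The period of `f` cancels in the difference, so it suffices to let `h` range over a compact set.
-/
theorem exists_rot_bound (hι : IsClosedSurfaceEmbedding ι) {f : H → ℝ} (hf : Continuous f)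
    (hfu : ∀ γ h, f (ι γ * h) = f h + (u γ).toAdd) :
    ∃ B : ℝ, ∀ h, ∀ θ ∈ Set.Icc (-Real.pi) Real.pi, |f (h * rot θ) - f h| ≤ B := by
  obtain ⟨K, hK, hcov⟩ := exists_isCompact_cover hι
  have hc : Continuous fun p : H × ℝ => f (p.1 * rot p.2) - f p.1 :=
    (hf.comp (continuous_fst.mul (continuous_rot.comp continuous_snd))).sub
      (hf.comp continuous_fst)
  obtain ⟨B, hB⟩ := (hK.prod (isCompact_Icc (a := -Real.pi) (b := Real.pi))
    ).exists_bound_of_continuousOn hc.continuousOn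
  refine ⟨B, fun h θ hθ => ?_⟩
  obtain ⟨γ, k, hk, rfl⟩ := hcov h
  rw [mul_assoc, hfu, hfu, add_sub_add_right_eq_sub]
  exact hB (k, θ) ⟨hk, hθ⟩

/-- For an Anosov deformation, `f` grows sublinearly along the flow. -/
theorem exists_increment_bound (hι : IsClosedSurfaceEmbedding ι)
    (hA : IsAnosov ι (linearDeformation ι u)) {f : H → ℝ} (hf : Continuous f)
    (hfu : ∀ γ h, f (ι γ * h) = f h + (u γ).toAdd) :
    ∃ a : ℝ, 0 < a ∧ a < 1 ∧ ∃ C : ℝ, ∀ (h : H) (t : ℝ),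
      |f (h * aFlow t) - f h| ≤ (1 - a) * |t| + C := by
  obtain ⟨a, ha, ha1, C, htri⟩ := exists_trichotomy hι hA hf hfu
  obtain ⟨B, hB⟩ := exists_rot_bound hι hf hfu
  have hpi := Real.pi_pos
  have hB' : ∀ h, |f (h * rot (Real.pi / 2)) - f h| ≤ B := fun h =>
    hB h _ ⟨by linarith, by linarith⟩
  have hpos : ∀ h, ∀ t > 0, |f (h * aFlow t) - f h| ≤ (1 - a) * t + C := by
    intro h
    rcases htri h with h1 | h1 | h1
    · exact h1
    · exact absurd h1 (not_fast_regime hf ha htri hB' h)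
    -- Replacing `f` by `-f` exchanges the two fast regimes.
    · refine absurd (fun t ht => ?_) (not_fast_regime (f := fun h => -f h) hf.neg ha (C := C)
        (B := B) (fun h => ?_) (fun h => ?_) h)
      · linarith [h1 t ht]
      · rcases htri h with h2 | h2 | h2
        · refine Or.inl fun t ht => ?_
          rw [neg_sub_neg, abs_sub_comm]
          exact h2 t ht
        · exact Or.inr (Or.inr fun t ht => by linarith [h2 t ht])
        · exact Or.inr (Or.inl fun t ht => by linarith [h2 t ht])
      · rw [neg_sub_neg, abs_sub_comm]
        exact hB' h
  refine ⟨a, ha, ha1, |C|, fun h t => ?_⟩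
  rcases lt_trichotomy t 0 with ht | rfl | ht
  · have h1 := hpos (h * aFlow t) (-t) (by linarith)
    rw [mul_aFlow_mul_aFlow_neg, abs_sub_comm] at h1
    rw [abs_of_neg ht]
    exact h1.trans (by linarith [le_abs_self C])
  · rw [aFlow_zero, mul_one]
    simp
  · rw [abs_of_pos ht]
    exact (hpos h t ht).trans (by linarith [le_abs_self C])

theorem exists_abs_le_of_isAnosov (hι : IsClosedSurfaceEmbedding ι)
    (hA : IsAnosov ι (linearDeformation ι u)) :
    ∃ κ : ℝ, 0 < κ ∧ κ < 1 / 2 ∧ ∀ γ, |(u γ).toAdd| ≤ κ * transLength ι γ := by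
  obtain ⟨f, hf, hfu⟩ := exists_continuous_equivariant hι u
  obtain ⟨a, ha, ha1, C, hC⟩ := exists_increment_bound hι hA hf hfu
  obtain ⟨B, hB⟩ := exists_rot_bound hι hf hfu
  obtain ⟨L, hL1, hL⟩ := exists_conj_entry_le_specRadius hι
  have hbound : ∀ γ, |(u γ).toAdd| ≤
      (1 - a) * Real.log (specRadius ι γ) + ((1 - a) * Real.log (4 * L) + C + 2 * B) := by
    intro γ
    obtain ⟨δ, hδ⟩ := hL γ
    have hr := one_le_specRadius (ι := ι) γ
    have hu : (u (δ⁻¹ * γ * δ)).toAdd = (u γ).toAdd := by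
      simp only [map_mul, map_inv, toAdd_mul, toAdd_inv]; ring
    rw [← hu]
    -- `u(γ)` is the increment of `f` from `1` to the conjugated element. Up to the two bounded
    -- rotations it is an increment along a flow segment, and `e^{|t|}` is controlled by the entries
    -- of that element.
    obtain ⟨θ, hθ, ψ, hψ, t, e⟩ := exists_cartan (ι (δ⁻¹ * γ * δ))
    have hent : ∀ i j, |aFlow t i j| ≤ 4 * L * specRadius ι γ := by
      intro i j
      have e2 : aFlow t = (rot ψ)⁻¹ * (ι (δ⁻¹ * γ * δ) * rot θ) := by
        rw [e, inv_mul_cancel_left]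
      rw [e2, Matrix.SpecialLinearGroup.coe_mul, Matrix.SpecialLinearGroup.coe_mul]
      exact (entry_mul_le (abs_rot_inv_le ψ) (entry_mul_le hδ (abs_rot_le θ)) i j).trans
        (le_of_eq (by ring))
    have hexp : Real.exp |t| ≤ 4 * L * specRadius ι γ := by
      have h1 := hent 0 0
      have h2 := hent 1 1
      simp only [aFlow] at h1 h2
      simp at h1 h2
      rcases abs_choice t with h | h <;> rw [h] <;> assumption
    have ht : |t| ≤ Real.log (4 * L) + Real.log (specRadius ι γ) := by
      rw [← Real.log_mul (by positivity) (by positivity)]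
      exact (Real.le_log_iff_exp_le (by positivity)).mpr hexp
    have h1 := hfu (δ⁻¹ * γ * δ) 1
    rw [mul_one] at h1
    have h2 := abs_le.mp (hB (ι (δ⁻¹ * γ * δ)) θ hθ)
    have h3 := abs_le.mp (hB 1 ψ hψ)
    have h4 := abs_le.mp (hC (rot ψ) t)
    rw [e] at h2
    rw [one_mul] at h3
    have h5 := mul_le_mul_of_nonneg_left ht (by linarith : 0 ≤ 1 - a)
    rw [abs_le]
    constructor <;> linarith [h2.1, h2.2, h3.1, h3.2, h4.1, h4.2]
  -- The factor `1/2` comes from `t(γ) = 2 log r(γ)`. Applying the bound to `γ ^ n` and dividing by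
  -- `n` removes the additive constant.
  refine ⟨(1 - a) / 2, by linarith, by linarith, fun γ => ?_⟩
  set D := (1 - a) * Real.log (4 * L) + C + 2 * B
  have hn : ∀ n : ℕ, 0 < n →
      |(u γ).toAdd| ≤ (1 - a) / 2 * transLength ι γ + D / n := by
    intro n hn
    have hn' : (0 : ℝ) < n := Nat.cast_pos.mpr hn
    have h1 := hbound (γ ^ n)
    rw [specRadius_pow, Real.log_pow, map_pow, toAdd_pow, nsmul_eq_mul, abs_mul,
      Nat.abs_cast] at h1
    have h2 : (1 - a) / 2 * transLength ι γ + D / n =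
        ((1 - a) * (n * Real.log (specRadius ι γ)) + D) / n := by
      rw [transLength]; field_simp
    rw [h2, le_div_iff₀ hn', mul_comm]
    exact h1
  have hlim : Tendsto (fun n : ℕ => (1 - a) / 2 * transLength ι γ + D / n) atTop
      (𝓝 ((1 - a) / 2 * transLength ι γ)) := by
    have := (tendsto_const_div_atTop_nhds_zero_nat D).const_add ((1 - a) / 2 * transLength ι γ)
    rwa [add_zero] at this
  refine ge_of_tendsto hlim ?_
  filter_upwards [eventually_gt_atTop 0] with n h0 using hn n h0

end Periods

end FlagAnosov

end

theorem mainTheorem2 {Γ : Type*} [Group Γ] (ι : Γ →* FlagAnosov.H)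
    (hι : FlagAnosov.IsClosedSurfaceEmbedding ι) (u : Γ →* Multiplicative ℝ) :
    FlagAnosov.IsAnosov ι (FlagAnosov.linearDeformation ι u) ↔
      FlagAnosov.stableNorm ι u < 1 / 2 := by
  rw [FlagAnosov.stableNorm_lt_half_iff hι u]
  constructor
  · exact FlagAnosov.exists_abs_le_of_isAnosov hι
  · rintro ⟨κ, hκ0, hκ, hu⟩
    exact FlagAnosov.isAnosov_of_abs_le hι hκ0.le hκ hu
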